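/- **Setting.** Let $1<k<n$ be integers, and let $B(0,1)$ be the closed unit ball of $\mathbb R^n$. Let $G(k,n)$ be the set of $k$-dimensional linear subspaces of $\mathbb R^n$ with the metric $d(V,V')=\|P_V-P_{V'}\|$ (operator norm of the difference of the orthogonal projections). Every affine $k$-plane is uniquely $W=\mathrm{dir}(W)+x_W$ with $\mathrm{dir}(W)\in G(k,n)$, $x_W\in \mathrm{dir}(W)^\perp$. Let $A_{\rm loc}(k,n)$ be the set of affine $k$-planes with $|x_W|\le 1/2$, with the metric $d(W,W')=d(\mathrm{dir}\,W,\mathrm{dir}\,W')+|x_W-x_{W'}|$. A subset $A$ of a metric space is a *$(\delta,s)$-set with constant $K$* if its points are pairwise at distance $\ge\delta$ and $\#(A\cap B_r(x))\le K(r/\delta)^s$ for all points $x$ of the space and all $\delta\le r\le 1$. For a plane $W\subset\mathbb R^n$ put $W_r=N_r(W)\cap B(0,1)$, where $N_r$ is the closed $r$-neighbourhood. For $V\in G(k,n)$ and a line $m\subset V$, the $(n-k+1)$-plane orthogonal to $V$ at $m$ is $m\oplus V^\perp$. With a comparability constant $C_0\ge1$, a *$\delta$-slab orthogonal to $V$*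 is a convex set $T$ such that $(m\oplus V^\perp)_{\delta/C_0}\subset T\subset (m\oplus V^\perp)_{C_0\delta}$ for some line $m\subset V$. **Theorem.** Let $0<\mu<1/100$, $t>k(n-k)-(k-1)$, $s>0$ and $0<u<t-k(n-k)+(k-1)$. There is $\varepsilon_0>0$, depending only on $\mu,n,k,s,t,u$, such that for all $C_0,K\ge1$ there is $C>0$, and for every $0<\varepsilon<\varepsilon_0$ there is moreover $C_\varepsilon>0$ (both constants depending only on $\mu,n,k,s,t,u,C_0,K$, and $C_\varepsilon$ also on $\varepsilon$), such that the following holds for every $0<\delta<1/100$. Let $A_\mu\subset A_{\rm loc}(1,n)$ and $G_\mu\subset G(k,n)$ be closed balls of radius $\mu$ such that $\angle(\ell,V^\perp)>\mu$ for all $\ell\in A_\mu$, $V\in G_\mu$. Let $\mathbf H\subset A_\mu$ be a $(\delta,u)$-set with constant $K$ and $\#\mathbf H\ge K^{-1}(\log\delta^{-1})^{-2}\delta^{-u}$, and let $\mathcal V\subset G_\mu$ be a $(\delta,t)$-set with constant $K$ and $\#\mathcal V\ge K^{-1}(\log\delta^{-1})^{-2}\delta^{-t}$. For each $V\in\mathcal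 V$ let $\mathbb T_V$ be a set of $\delta$-slabs orthogonal to $V$ (with comparability constant $C_0$) such that $$\#\{T\in\mathbb T_V: T\subset (m\oplus V^\perp)_r\}\le K(r/\delta)^s$$ for all $\delta\le r\le1$ and all lines $m\subset V$. Suppose that for each $\ell\in\mathbf H$ $$\#\{V\in\mathcal V: \ell_\delta\subset T\text{ for some }T\in\mathbb T_V\}\ge K^{-1}(\log\delta^{-1})^{-2}\,\#\mathcal V.$$ Then every $\mathbb T_V$ with $V\in\mathcal V$ is finite, and $$\delta^{-u-t}\le C_\varepsilon\,\delta^{-\varepsilon/2}\sum_{V\in\mathcal V}\#\mathbb T_V,\qquad \delta^{-\varepsilon/2}\sum_{V\in\mathcal V}\#\mathbb T_V\le C\,\delta^{-\varepsilon-t-s}.$$ -/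

import Mathlib

namespace LineProjection

/-- The Grassmannian `G(k,n)`: the `k`-dimensional linear subspaces of Euclidean `ℝⁿ`. -/
structure Gr (n k : ℕ) where
  /-- the underlying subspace -/
  space : Submodule ℝ (EuclideanSpace ℝ (Fin n))
  finrank_space : Module.finrank ℝ space = k

/-- The metric `d(V₁,V₂) = ‖π_{V₁} - π_{V₂}‖`: the operator norm of the difference of the
orthogonal projections. -/
noncomputable instance (n k : ℕ) : MetricSpace (Gr n k) where
  dist V₁ V₂ := ‖V₁.space.starProjection - V₂.space.starProjection‖
  dist_self V := by simp
  dist_comm V₁ V₂ := norm_sub_rev _ _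
  dist_triangle V₁ V₂ V₃ := norm_sub_le_norm_sub_add_norm_sub _ _ _
  eq_of_dist_eq_zero {V₁ V₂} h := by
    obtain ⟨V₁, h₁⟩ := V₁
    obtain ⟨V₂, h₂⟩ := V₂
    have h' : V₁.starProjection = V₂.starProjection := sub_eq_zero.mp (norm_eq_zero.mp h)
    have : V₁ = V₂ := Submodule.starProjection_inj.mp h'
    subst this
    rfl

/-- The affine Grassmannian `A(k,n)`: every `k`-dimensional affine subspace of `ℝⁿ` is uniquely of
the form `dir + foot`, with `dir` a `k`-dimensional linear subspace and `foot ∈ dirᗮ`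
(see `AffGr.exists_unique`), and it is stored as that pair. -/
structure AffGr (n k : ℕ) where
  /-- the direction of the plane -/
  dir : Gr n k
  /-- the point of the plane that is closest to the origin -/
  foot : EuclideanSpace ℝ (Fin n)
  foot_mem : foot ∈ dir.spaceᗮ

/-- The affine subspace `dir + foot`. -/
noncomputable def AffGr.toAffineSubspace {n k : ℕ} (W : AffGr n k) :
    AffineSubspace ℝ (EuclideanSpace ℝ (Fin n)) :=
  AffineSubspace.mk' W.foot W.dir.space

/-- The set of points of the plane. -/
def AffGr.points {n k : ℕ} (W : AffGr n k) : Set (EuclideanSpace ℝ (Fin n)) :=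
  W.toAffineSubspace

theorem AffGr.mem_points {n k : ℕ} (W : AffGr n k) (x : EuclideanSpace ℝ (Fin n)) :
    x ∈ W.points ↔ x - W.foot ∈ W.dir.space := by
  simp [AffGr.points, AffGr.toAffineSubspace, AffineSubspace.mem_mk']

theorem AffGr.exists_unique {n k : ℕ} (A : AffineSubspace ℝ (EuclideanSpace ℝ (Fin n)))
    (hA : (A : Set (EuclideanSpace ℝ (Fin n))).Nonempty)
    (hk : Module.finrank ℝ A.direction = k) :
    ∃! W : AffGr n k, W.toAffineSubspace = A := by
  obtain ⟨p, hp⟩ := hA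
  have key : p - A.directionᗮ.starProjection p ∈ A.direction := by
    have := A.directionᗮ.sub_starProjection_mem_orthogonal p
    rwa [Submodule.orthogonal_orthogonal] at this
  refine ⟨⟨⟨A.direction, hk⟩, A.directionᗮ.starProjection p,
    Submodule.starProjection_apply_mem _ _⟩, ?_, ?_⟩
  · show AffineSubspace.mk' _ A.direction = A
    have hq : A.directionᗮ.starProjection p ∈ A := by
      have h2 := AffineSubspace.vadd_mem_of_mem_direction (A.direction.neg_mem key) hp
      simpa only [vadd_eq_add, neg_sub, sub_add_cancel] using h2
    exact AffineSubspace.mk'_eq hq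
  · rintro ⟨⟨D, hD⟩, f, hf⟩ hW
    change AffineSubspace.mk' f D = A at hW
    subst hW
    have hdir : (AffineSubspace.mk' f D).direction = D := AffineSubspace.direction_mk' f D
    have hpf : p - f ∈ D := by simpa [AffineSubspace.mem_mk'] using hp
    have hfoot : f = Dᗮ.starProjection p := by
      have e : p = (p - f) + f := by abel
      rw [e, map_add, Submodule.starProjection_eq_self_iff.mpr hf]
      have : Dᗮ.starProjection (p - f) = 0 := by
        rw [Submodule.starProjection_apply_eq_zero_iff, Submodule.orthogonal_orthogonal]
        exact hpf
      rw [this, zero_add]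
    congr 1
    · congr 1
      exact hdir.symm
    · rw [hdir]
      exact hfoot

/-- The metric `d(W₁,W₂) = d(dir W₁, dir W₂) + |x_{W₁} - x_{W₂}|`. -/
noncomputable instance (n k : ℕ) : MetricSpace (AffGr n k) where
  dist W₁ W₂ := dist W₁.dir W₂.dir + dist W₁.foot W₂.foot
  dist_self W := by simp
  dist_comm W₁ W₂ := by rw [dist_comm W₁.dir, dist_comm W₁.foot]
  dist_triangle W₁ W₂ W₃ := by
    have h₁ := dist_triangle W₁.dir W₂.dir W₃.dir
    have h₂ := dist_triangle W₁.foot W₂.foot W₃.foot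
    linarith
  eq_of_dist_eq_zero {W₁ W₂} h := by
    obtain ⟨d₁, f₁, h₁⟩ := W₁
    obtain ⟨d₂, f₂, h₂⟩ := W₂
    change dist d₁ d₂ + dist f₁ f₂ = 0 at h
    have hd : 0 ≤ dist d₁ d₂ := dist_nonneg
    have hf : 0 ≤ dist f₁ f₂ := dist_nonneg
    obtain rfl : d₁ = d₂ := dist_eq_zero.mp (by linarith)
    obtain rfl : f₁ = f₂ := dist_eq_zero.mp (by linarith)
    rfl

/-- `A_loc(k,n)`: the affine `k`-planes whose foot point lies in the ball of radius `1/2` about the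
origin, with the metric inherited from `AffGr n k`. -/
abbrev ALoc (n k : ℕ) := {W : AffGr n k // ‖W.foot‖ ≤ 1 / 2}

/-- `#A ≤ x`; in particular `A` is finite. -/
def CardLE {α : Type*} (A : Set α) (x : ℝ) : Prop :=
  A.Finite ∧ (A.ncard : ℝ) ≤ x

/-- `A` is a `(δ,s)`-set with constant `K`: it is `δ`-separated, and
`#(A ∩ B_r(x)) ≤ K (r/δ)^s` for all points `x` of the ambient space and all `δ ≤ r ≤ 1`. -/
def IsDeltaSet {α : Type*} [MetricSpace α] (δ s K : ℝ) (A : Set α) : Prop :=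
  (∀ x ∈ A, ∀ y ∈ A, x ≠ y → δ ≤ dist x y) ∧
  ∀ (x : α) (r : ℝ), δ ≤ r → r ≤ 1 → CardLE (A ∩ Metric.closedBall x r) (K * (r / δ) ^ s)

/-- `N_r(W) ∩ B(0,1)`: for a plane `W` this is the slab `W_r`. -/
def slab {n : ℕ} (r : ℝ) (W : Set (EuclideanSpace ℝ (Fin n))) :
    Set (EuclideanSpace ℝ (Fin n)) :=
  Metric.cthickening r W ∩ Metric.closedBall 0 1

/-- The plane `m ⊕ Vᗮ`, for a line `m` contained in `V`: the `(n-k+1)`-plane that is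
orthogonal to `V` at `m`. -/
def orthPlane {n k : ℕ} (V : Gr n k) (m : AffGr n 1) : Set (EuclideanSpace ℝ (Fin n)) :=
  {z | ∃ x ∈ m.points, ∃ y ∈ V.spaceᗮ, z = x + y}

/-- `T` is an `r`-slab that is orthogonal to `V` at an `r`-tube in `V`, up to the comparability
constant `C`: it is convex, and it lies between the slabs of thickness `r/C` and `C r` around a
plane `m ⊕ Vᗮ` with `m` a line in `V`. For `C = 1` this is exactly the slab `(m ⊕ Vᗮ)_r`. -/
def IsOrthSlab {n k : ℕ} (C r : ℝ) (V : Gr n k) (T : Set (EuclideanSpace ℝ (Fin n))) : Prop :=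
  Convex ℝ T ∧ ∃ m : AffGr n 1, m.points ⊆ V.space ∧
    slab (r / C) (orthPlane V m) ⊆ T ∧ T ⊆ slab (C * r) (orthPlane V m)

/-- The `s`-dimensional Frostman condition with constant `K`, at scale `δ`, for a family `𝕋` of
slabs: at most `K (r/δ)^s` members of `𝕋` lie in any given slab of thickness `r ∈ [δ,1]` around an
`(n-k+1)`-plane orthogonal to `V` at a line in `V`. -/
def FrostmanSlabs {n k : ℕ} (δ s K : ℝ) (V : Gr n k)
    (𝕋 : Set (Set (EuclideanSpace ℝ (Fin n)))) : Prop :=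
  ∀ r : ℝ, δ ≤ r → r ≤ 1 → ∀ m : AffGr n 1, m.points ⊆ V.space →
    CardLE {T ∈ 𝕋 | T ⊆ slab r (orthPlane V m)} (K * (r / δ) ^ s)

/-- `∠(ℓ, Vᗮ) > μ`: every nonzero direction of `ℓ` makes an angle greater than `μ` with every
nonzero vector of `Vᗮ`. -/
def AngleGT {n k : ℕ} (μ : ℝ) (l : AffGr n 1) (V : Gr n k) : Prop :=
  ∀ v ∈ l.dir.space, v ≠ 0 → ∀ w ∈ V.spaceᗮ, w ≠ 0 → μ < InnerProductGeometry.angle v w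

end LineProjection

open LineProjection

/-! The lower bound is a Kaufman-type L² argument. Put γ = t − k(n−k) + (k−1) and count triples (ℓ,
ℓ', V) for which one slab of 𝕋_V contains both tubes. Cauchy–Schwarz (`sq_sum_card_covered_le`)
bounds the square of the number of covered pairs (ℓ, V) by (Σ_V #𝕋_V) times the number of triples.

The heart is the bound for two lines at distance r (`exists_card_common_slab_le`): they share a slab
for at most about δ^{-t}(δ/r)^γ planes V. They determine an orthonormal pair v, e, and a common slab
makes P_V v and P_V e almost parallel to one line m (`exists_almost_dependent`). Since ∠(ℓ, V^⊥) > μ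
keeps P_V v away from 0, this gives P_V(e − cv) = O(δ/r) with c bounded. For fixed c, the k-planes
orthogonal to e − cv form a k(n−k−1)-dimensional family; the parameter c adds one dimension, giving
k(n−k) − (k−1) = t − γ. At scale ρ = δ/r there are thus about ρ^{γ−t} clusters of diameter O(ρ),
each with O((ρ/δ)^t) members of 𝒱.

As u < γ, summing over ℓ' in dyadic rings converges (`IsDeltaSet.sum_rpow_le`), so each ℓ lies in
O(δ^{-t}) triples. Dividing gives the lower bound up to powers of log δ⁻¹, absorbed by δ^{-ε/2}. The
upper bound only needs the counts of 𝒱 and 𝕋_V at radius 1. -/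

/-! ### Orthogonal projections and subspaces as graphs -/

section Projections

variable {E : Type*} [NormedAddCommGroup E] [InnerProductSpace ℝ E] [FiniteDimensional ℝ E]

theorem norm_sub_starProjection_le_of_mem (U : Submodule ℝ E) {x y : E} (hy : y ∈ U) :
    ‖x - U.starProjection x‖ ≤ ‖x - y‖ := by
  have h := Submodule.norm_starProjection_apply_le Uᗮ (x - y)
  rw [Submodule.starProjection_orthogonal_val, map_sub,
    Submodule.starProjection_eq_self_iff.mpr hy] at h
  simpa using h

/-- P_U − P_V = P_{V^⊥}P_U − P_V P_{U^⊥}. The hypothesis on U controls the first term; the second is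
the adjoint of P_{U^⊥}P_V, which the hypothesis on V controls. -/
theorem norm_starProjection_sub_le (U V : Submodule ℝ E) {η : ℝ} (hη : 0 ≤ η)
    (hUV : ∀ x ∈ U, ‖x - V.starProjection x‖ ≤ η * ‖x‖)
    (hVU : ∀ x ∈ V, ‖x - U.starProjection x‖ ≤ η * ‖x‖) :
    ‖U.starProjection - V.starProjection‖ ≤ 2 * η := by
  refine ContinuousLinearMap.opNorm_le_bound _ (by positivity) fun x => ?_
  have h1 := hUV (U.starProjection x) (Submodule.starProjection_apply_mem _ _)
  have h1' := mul_le_mul_of_nonneg_left (Submodule.norm_starProjection_apply_le U x) hη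
  set z := V.starProjection (x - U.starProjection x) with hz
  have h2 : ‖z‖ ≤ η * ‖x‖ := by
    have hzV : z ∈ V := Submodule.starProjection_apply_mem _ _
    have e1 : inner ℝ z z = inner ℝ (z - U.starProjection z) x := by
      have a1 : inner ℝ z z = inner ℝ z (x - U.starProjection x) := by
        conv_lhs => rw [hz, ← hz, ← Submodule.inner_starProjection_left_eq_right]
        rw [Submodule.starProjection_eq_self_iff.mpr hzV]
      rw [a1, inner_sub_right, inner_sub_left, Submodule.inner_starProjection_left_eq_right U z x]
    rw [real_inner_self_eq_norm_sq] at e1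
    have e2 := real_inner_le_norm (z - U.starProjection z) x
    have e3 := mul_le_mul_of_nonneg_right (hVU z hzV) (norm_nonneg x)
    rcases (norm_nonneg z).eq_or_lt with h0 | h0
    · rw [← h0]; positivity
    · refine le_of_mul_le_mul_left ?_ h0
      nlinarith
  have e : (U.starProjection - V.starProjection) x =
      (U.starProjection x - V.starProjection (U.starProjection x)) - z := by
    simp [hz, map_sub]
  rw [e]
  have := norm_sub_le (U.starProjection x - V.starProjection (U.starProjection x)) z
  linarith

theorem norm_starProjection_sub_apply_le {U V : Submodule ℝ E} {η : ℝ}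
    (h : ‖U.starProjection - V.starProjection‖ ≤ η) (x : E) :
    ‖U.starProjection x - V.starProjection x‖ ≤ η * ‖x‖ :=
  (ContinuousLinearMap.le_opNorm (U.starProjection - V.starProjection) x).trans
    (mul_le_mul_of_nonneg_right h (norm_nonneg x))

theorem norm_le_two_mul_norm_starProjection {U V : Submodule ℝ E}
    (h : ‖V.starProjection - U.starProjection‖ ≤ 1 / 2) {x : E} (hx : x ∈ V) :
    ‖x‖ ≤ 2 * ‖U.starProjection x‖ := by
  have h1 := norm_starProjection_sub_apply_le h x
  rw [Submodule.starProjection_eq_self_iff.mpr hx] at h1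
  have h2 := norm_sub_norm_le x (U.starProjection x)
  linarith

/-- Nearby subspaces of equal dimension are graphs over each other: the projection V → U is bounded
below, hence injective, hence onto. -/
theorem exists_mem_starProjection_eq {U V : Submodule ℝ E}
    (h : ‖V.starProjection - U.starProjection‖ ≤ 1 / 2)
    (hd : Module.finrank ℝ V = Module.finrank ℝ U) {b : E} (hb : b ∈ U) :
    ∃ y ∈ V, U.starProjection y = b := by
  let f : V →ₗ[ℝ] U :=
    (U.starProjection.toLinearMap.comp V.subtype).codRestrict U
      fun x => Submodule.starProjection_apply_mem _ _
  have hinj : Function.Injective f := by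
    rw [injective_iff_map_eq_zero]
    intro x hx
    have h0 : U.starProjection (x : E) = 0 := congrArg Subtype.val hx
    have := norm_le_two_mul_norm_starProjection h x.2
    rw [h0, norm_zero, mul_zero] at this
    exact Subtype.ext (norm_le_zero_iff.mp this)
  obtain ⟨y, hy⟩ :=
    (LinearMap.injective_iff_surjective_of_finrank_eq_finrank hd).mp hinj ⟨b, hb⟩
  exact ⟨y, y.2, congrArg Subtype.val hy⟩

/-- Two subspaces that are graphs over `U`, with graph vectors over an orthonormal basis of `U`
that are `η`-close, are close. -/
theorem norm_starProjection_sub_le_of_graph {ι : Type*} [Fintype ι] {U V V' : Submodule ℝ E}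
    (h : ‖V.starProjection - U.starProjection‖ ≤ 1 / 2)
    (h' : ‖V'.starProjection - U.starProjection‖ ≤ 1 / 2)
    (b : OrthonormalBasis ι ℝ U) {y y' : ι → E} {η : ℝ} (hη : 0 ≤ η)
    (hy : ∀ i, y i ∈ V) (hy' : ∀ i, y' i ∈ V')
    (hb : ∀ i, U.starProjection (y i) = b i) (hb' : ∀ i, U.starProjection (y' i) = b i)
    (hyy : ∀ i, ‖y i - y' i‖ ≤ η) :
    ‖V.starProjection - V'.starProjection‖ ≤ 2 * (Fintype.card ι * η) := by
  have key : ∀ {V V' : Submodule ℝ E} {y y' : ι → E},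
      ‖V.starProjection - U.starProjection‖ ≤ 1 / 2 → (∀ i, y i ∈ V) → (∀ i, y' i ∈ V') →
      (∀ i, U.starProjection (y i) = b i) → (∀ i, ‖y i - y' i‖ ≤ η) →
      ∀ x ∈ V, ‖x - V'.starProjection x‖ ≤ Fintype.card ι * η * ‖x‖ := by
    intro V V' y y' h hy hy' hb hyy x hx
    let p : U := ⟨U.starProjection x, Submodule.starProjection_apply_mem _ _⟩
    have hp : ∑ i, inner ℝ (b i) p • ((b i : U) : E) = U.starProjection x := by
      have := congrArg Subtype.val (b.sum_repr' p)
      simpa using this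
    -- The difference of the two sides lies in V and projects to 0 in U, so it vanishes.
    have hxs : x = ∑ i, inner ℝ (b i) p • y i := by
      have hm : x - ∑ i, inner ℝ (b i) p • y i ∈ V :=
        V.sub_mem hx (V.sum_mem fun i _ => V.smul_mem _ (hy i))
      have h0 := norm_le_two_mul_norm_starProjection h hm
      rw [map_sub, map_sum] at h0
      simp only [map_smul, hb, hp, sub_self, norm_zero, mul_zero] at h0
      exact sub_eq_zero.mp (norm_le_zero_iff.mp h0)
    have hmem : ∑ i, inner ℝ (b i) p • y' i ∈ V' :=
      V'.sum_mem fun i _ => V'.smul_mem _ (hy' i)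
    refine (norm_sub_starProjection_le_of_mem V' hmem).trans ?_
    have hpn : ‖p‖ ≤ ‖x‖ := Submodule.norm_starProjection_apply_le U x
    calc ‖x - ∑ i, inner ℝ (b i) p • y' i‖
        = ‖∑ i, inner ℝ (b i) p • (y i - y' i)‖ := by
          conv_lhs => rw [hxs]
          rw [← Finset.sum_sub_distrib]
          simp only [smul_sub]
      _ ≤ ∑ i : ι, ‖x‖ * η := by
          refine (norm_sum_le _ _).trans (Finset.sum_le_sum fun i _ => ?_)
          rw [norm_smul]
          refine mul_le_mul ?_ (hyy i) (norm_nonneg _) (norm_nonneg _)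
          have := norm_inner_le_norm (𝕜 := ℝ) (b i) p
          rw [b.norm_eq_one, one_mul] at this
          exact this.trans hpn
      _ = Fintype.card ι * η * ‖x‖ := by simp; ring
  refine norm_starProjection_sub_le V V' (by positivity) (key h hy hy' hb hyy)
    (key h' hy' hy hb' fun i => ?_)
  rw [norm_sub_rev]
  exact hyy i

/-- A vector orthogonal to `U` is controlled by its inner product with a vector `f` not in `U`
and its coordinates along an orthonormal basis of the orthogonal complement of `U + ℝ f`. -/
theorem norm_le_of_mem_orthogonal {ι : Type*} [Fintype ι] {U W : Submodule ℝ E} {f d : E}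
    (hW : W = (U ⊔ ℝ ∙ f)ᗮ) (w : OrthonormalBasis ι ℝ W) (hf : 1 / 2 ≤ ‖f - U.starProjection f‖)
    (hd : d ∈ Uᗮ) {a ρ : ℝ} (hdf : |inner ℝ d f| ≤ a) (hdw : ∀ j, |inner ℝ d (w j : E)| ≤ ρ) :
    ‖d‖ ≤ Fintype.card ι * ρ + 2 * a := by
  set g := f - U.starProjection f with hg
  have hgU : g ∈ Uᗮ := Submodule.sub_starProjection_mem_orthogonal f
  have h1 : ‖W.starProjection d‖ ≤ Fintype.card ι * ρ := by
    let p : W := ⟨W.starProjection d, Submodule.starProjection_apply_mem _ _⟩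
    have hp : ‖p‖ = ‖W.starProjection d‖ := rfl
    rw [← hp, ← w.sum_repr' p]
    refine (norm_sum_le _ _).trans ?_
    have : ∀ j ∈ Finset.univ, ‖inner ℝ (w j) p • w j‖ ≤ ρ := by
      intro j _
      rw [norm_smul, w.norm_eq_one, mul_one, Real.norm_eq_abs]
      have e : inner ℝ (w j) p = inner ℝ d (w j : E) := by
        change inner ℝ (w j : E) (W.starProjection d) = _
        rw [← Submodule.inner_starProjection_left_eq_right,
          Submodule.starProjection_eq_self_iff.mpr (w j).2, real_inner_comm]
      rw [e]
      exact hdw j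
    refine (Finset.sum_le_sum this).trans ?_
    simp
  set q := d - W.starProjection d with hq
  have hqW : q ∈ U ⊔ ℝ ∙ f := by
    have : q ∈ Wᗮ := Submodule.sub_starProjection_mem_orthogonal d
    rwa [hW, Submodule.orthogonal_orthogonal] at this
  have hWU : ∀ z ∈ W, z ∈ Uᗮ := fun z hz =>
    Submodule.orthogonal_le le_sup_left (hW ▸ hz)
  have hqU : q ∈ Uᗮ := Uᗮ.sub_mem hd (hWU _ (Submodule.starProjection_apply_mem _ _))
  obtain ⟨u, hu, z, hz, huz⟩ := Submodule.mem_sup.mp hqW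
  obtain ⟨c, rfl⟩ := Submodule.mem_span_singleton.mp hz
  -- (U + ℝf) ∩ U^⊥ is the line through g, so the remainder q is determined by its product with f.
  have hqg : q = c • g := by
    have hm : u + c • U.starProjection f ∈ U :=
      U.add_mem hu (U.smul_mem _ (Submodule.starProjection_apply_mem _ _))
    have hm' : u + c • U.starProjection f ∈ Uᗮ := by
      have : u + c • U.starProjection f = q - c • g := by
        rw [← huz, hg, smul_sub]; abel
      rw [this]
      exact Uᗮ.sub_mem hqU (Uᗮ.smul_mem _ hgU)
    have h0 : u + c • U.starProjection f = 0 := by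
      have := Submodule.inner_right_of_mem_orthogonal hm hm'
      exact inner_self_eq_zero.mp this
    rw [← huz, hg, smul_sub, eq_neg_of_add_eq_zero_left h0]
    abel
  have hqf : inner ℝ q f = inner ℝ d f := by
    have hfW : f ∈ Wᗮ := by
      rw [hW, Submodule.orthogonal_orthogonal]
      exact Submodule.mem_sup_right (Submodule.mem_span_singleton_self f)
    rw [hq, inner_sub_left,
      Submodule.inner_right_of_mem_orthogonal (Submodule.starProjection_apply_mem W d) hfW, sub_zero]
  have hqf' : inner ℝ q f = c * ‖g‖ ^ 2 := by
    have e : f = g + U.starProjection f := by rw [hg]; abel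
    rw [e, inner_add_right, Submodule.inner_left_of_mem_orthogonal
      (Submodule.starProjection_apply_mem U f) hqU, hqg, inner_smul_left,
      real_inner_self_eq_norm_sq]
    simp
  have h2 : ‖q‖ ≤ 2 * a := by
    rw [hqg, norm_smul, Real.norm_eq_abs]
    have h3 : |c| * ‖g‖ ^ 2 ≤ a := by
      rw [← hqf, hqf', abs_mul, abs_of_nonneg (sq_nonneg ‖g‖)] at hdf
      exact hdf
    nlinarith [mul_nonneg (abs_nonneg c) (norm_nonneg g)]
  have e : d = W.starProjection d + q := by rw [hq]; abel
  rw [e]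
  exact (norm_add_le _ _).trans (add_le_add h1 h2)

end Projections

/-! ### Counting k-planes by coordinates -/

/-- If a bounded `ι`-tuple of real functions separates the members of `S` up to groups of at most
`B` at resolution `ρ`, then `#S ≲ ρ ^ (-#ι) B`. -/
theorem card_le_of_bounded_coordinates {α ι : Type*} [Fintype ι] (S : Finset α) (φ : α → ι → ℝ)
    {M ρ B : ℝ} (hM : 0 ≤ M) (hρ : 0 < ρ) (hρ1 : ρ ≤ 1) (hB : 0 ≤ B)
    (hφ : ∀ a ∈ S, ∀ i, |φ a i| ≤ M)
    (h : ∀ S' ⊆ S, (∀ a ∈ S', ∀ a' ∈ S', ∀ i, |φ a i - φ a' i| ≤ ρ) → (S'.card : ℝ) ≤ B) :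
    (S.card : ℝ) ≤ ((2 * M + 2) / ρ) ^ Fintype.card ι * B := by
  classical
  let lab : α → ι → ℤ := fun a i => ⌊φ a i / ρ⌋
  let R : Finset (ι → ℤ) := Fintype.piFinset fun _ => Finset.Icc ⌊-M / ρ⌋ ⌊M / ρ⌋
  have hmaps : ∀ a ∈ S, lab a ∈ R := by
    intro a ha
    simp only [R, Fintype.mem_piFinset, Finset.mem_Icc, lab]
    intro i
    have := abs_le.mp (hφ a ha i)
    exact ⟨Int.floor_le_floor (by gcongr; exact this.1), Int.floor_le_floor (by gcongr; exact this.2)⟩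
  have hfib : ∀ b ∈ R, (S.filter fun a => lab a = b).card ≤ ⌊B⌋₊ := by
    intro b _
    refine Nat.le_floor (h _ (Finset.filter_subset _ _) ?_)
    intro a ha a' ha' i
    have e : ⌊φ a i / ρ⌋ = ⌊φ a' i / ρ⌋ := by
      have := (Finset.mem_filter.mp ha).2.trans (Finset.mem_filter.mp ha').2.symm
      exact congrFun this i
    have h1 := Int.abs_sub_lt_one_of_floor_eq_floor e
    rw [← sub_div, abs_div, abs_of_pos hρ, div_lt_one hρ] at h1
    exact h1.le
  have h1 := Finset.card_le_mul_card_image_of_maps_to hmaps _ hfib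
  have h2 : (R.card : ℝ) ≤ ((2 * M + 2) / ρ) ^ Fintype.card ι := by
    simp only [R, Fintype.card_piFinset, Finset.prod_const, Finset.card_univ]
    push_cast
    refine pow_le_pow_left₀ (by positivity) ?_ _
    rw [Int.card_Icc]
    have a1 := Int.floor_le (M / ρ)
    have a2 := Int.lt_floor_add_one (-M / ρ)
    have a3 : ⌊-M / ρ⌋ ≤ ⌊M / ρ⌋ := Int.floor_le_floor (by gcongr; linarith)
    have a4 : (((⌊M / ρ⌋ + 1 - ⌊-M / ρ⌋).toNat : ℕ) : ℝ) =
        (⌊M / ρ⌋ : ℝ) + 1 - (⌊-M / ρ⌋ : ℝ) := by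
      have : (((⌊M / ρ⌋ + 1 - ⌊-M / ρ⌋).toNat : ℕ) : ℤ) = ⌊M / ρ⌋ + 1 - ⌊-M / ρ⌋ :=
        Int.toNat_of_nonneg (by linarith)
      exact_mod_cast this
    rw [a4]
    -- An interval of length 2M meets at most 2M/ρ + 2 cells; ρ ≤ 1 turns this into (2M + 2)/ρ.
    have a5 : (1 : ℝ) ≤ 1 / ρ := by rw [le_div_iff₀ hρ]; linarith
    have a6 : (2 * M + 2) / ρ = M / ρ - (-M / ρ) + 2 * (1 / ρ) := by ring
    rw [a6]
    linarith
  calc (S.card : ℝ) ≤ (⌊B⌋₊ : ℝ) * R.card := by exact_mod_cast h1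
    _ ≤ B * R.card := by gcongr; exact Nat.floor_le hB
    _ ≤ B * ((2 * M + 2) / ρ) ^ Fintype.card ι := by gcongr
    _ = _ := mul_comm _ _

namespace LineProjection

theorem Gr.dist_eq {n k : ℕ} (V V' : Gr n k) :
    dist V V' = ‖V.space.starProjection - V'.space.starProjection‖ := rfl

theorem finrank_orthogonal_sup_span {n k : ℕ} (V : Gr n k) {f : EuclideanSpace ℝ (Fin n)}
    (hf : f ∉ V.space) :
    Module.finrank ℝ ((V.space ⊔ ℝ ∙ f)ᗮ : Submodule ℝ (EuclideanSpace ℝ (Fin n))) =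
      n - k - 1 := by
  have hf0 : f ≠ 0 := fun h => hf (h ▸ V.space.zero_mem)
  have hd : V.space ⊓ ℝ ∙ f = ⊥ :=
    (Submodule.disjoint_span_singleton_of_notMem hf).eq_bot
  have h1 := Submodule.finrank_sup_add_finrank_inf_eq V.space (ℝ ∙ f)
  rw [hd, finrank_bot, finrank_span_singleton hf0, V.finrank_space] at h1
  have h2 := Submodule.finrank_add_finrank_orthogonal (V.space ⊔ ℝ ∙ f)
  rw [finrank_euclideanSpace_fin] at h2
  omega

/-- The `k`-planes that are almost orthogonal to a given vector form a `k (n - k - 1)`-dimensional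
family. -/
theorem card_le_of_almost_orthogonal {n k : ℕ} {L ρ B : ℝ} (hL : 0 ≤ L)
    (hρ : 0 < ρ) (hρ1 : ρ ≤ 1) (hLρ : L * ρ ≤ 1 / 2) (hB : 0 ≤ B)
    {f : EuclideanSpace ℝ (Fin n)} (hf : 1 ≤ ‖f‖)
    (S : Finset (Gr n k)) (hS : ∀ V ∈ S, ∀ V' ∈ S, dist V V' ≤ 1 / 2)
    (hSf : ∀ V ∈ S, ‖V.space.starProjection f‖ ≤ L * ρ)
    (h : ∀ S' ⊆ S, (∀ V ∈ S', ∀ V' ∈ S', dist V V' ≤ 2 * k * (n + 8 * L) * ρ) →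
      (S'.card : ℝ) ≤ B) :
    (S.card : ℝ) ≤ (6 / ρ) ^ (k * (n - k - 1)) * B := by
  classical
  rcases S.eq_empty_or_nonempty with rfl | ⟨V₁, hV₁⟩
  · simp only [Finset.card_empty, Nat.cast_zero]; positivity
  set U := V₁.space with hU
  have hg : 1 / 2 ≤ ‖f - U.starProjection f‖ := by
    have h1 := norm_sub_norm_le f (U.starProjection f)
    have h2 := hSf V₁ hV₁
    linarith
  have hfU : f ∉ U := by
    intro hfU
    rw [Submodule.starProjection_eq_self_iff.mpr hfU, sub_self, norm_zero] at hg
    linarith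
  let b := stdOrthonormalBasis ℝ U
  let w := stdOrthonormalBasis ℝ ((U ⊔ ℝ ∙ f)ᗮ : Submodule ℝ (EuclideanSpace ℝ (Fin n)))
  have hex : ∀ V : Gr n k, ∀ i, ∃ y, V ∈ S → y ∈ V.space ∧ U.starProjection y = b i := by
    intro V i
    by_cases hV : V ∈ S
    · obtain ⟨y, hy, hy'⟩ := exists_mem_starProjection_eq (U := U) (V := V.space)
        (hS V hV V₁ hV₁) (V.finrank_space.trans V₁.finrank_space.symm) (b i).2
      exact ⟨y, fun _ => ⟨hy, hy'⟩⟩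
    · exact ⟨0, fun h => absurd h hV⟩
  choose y hy using hex
  have hyn : ∀ V ∈ S, ∀ i, ‖y V i‖ ≤ 2 := by
    intro V hV i
    have h1 := norm_le_two_mul_norm_starProjection (hS V hV V₁ hV₁) (hy V i hV).1
    rw [← hU, (hy V i hV).2] at h1
    have h2 : ‖((b i : U) : EuclideanSpace ℝ (Fin n))‖ = 1 := b.norm_eq_one i
    linarith
  have hyf : ∀ V ∈ S, ∀ i, |inner ℝ (y V i) f| ≤ 2 * (L * ρ) := by
    intro V hV i
    have e : inner ℝ (y V i) f = inner ℝ (y V i) (V.space.starProjection f) := by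
      rw [← Submodule.inner_starProjection_left_eq_right,
        Submodule.starProjection_eq_self_iff.mpr (hy V i hV).1]
    rw [e]
    exact (abs_real_inner_le_norm _ _).trans
      (mul_le_mul (hyn V hV i) (hSf V hV) (norm_nonneg _) (by norm_num))
  -- The U-part of each graph vector is fixed and its product with f is O(ρ) by `hyf`, so the
  -- k(n−k−1) products with the `w j` are the only free coordinates.
  let φ : Gr n k → (Fin (Module.finrank ℝ U) × Fin (Module.finrank ℝ
    ((U ⊔ ℝ ∙ f)ᗮ : Submodule ℝ (EuclideanSpace ℝ (Fin n))))) → ℝ :=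
    fun V p => inner ℝ (y V p.1) (w p.2 : EuclideanSpace ℝ (Fin n))
  have hφ : ∀ V ∈ S, ∀ p, |φ V p| ≤ 2 := by
    intro V hV p
    refine (abs_real_inner_le_norm _ _).trans ?_
    have h2 : ‖((w p.2 : _) : EuclideanSpace ℝ (Fin n))‖ = 1 := w.norm_eq_one p.2
    rw [h2, mul_one]
    exact hyn V hV p.1
  have hWc := finrank_orthogonal_sup_span V₁ hfU
  have hUc : Module.finrank ℝ U = k := V₁.finrank_space
  have key := card_le_of_bounded_coordinates S φ (by norm_num : (0 : ℝ) ≤ 2) hρ hρ1 hB hφ ?_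
  · rw [Fintype.card_prod, Fintype.card_fin, Fintype.card_fin, hWc, hUc] at key
    norm_num at key
    exact key
  · intro S' hS' hclose
    refine h S' hS' fun V hV V' hV' => ?_
    have hdiff : ∀ i, ‖y V i - y V' i‖ ≤ (n + 8 * L) * ρ := by
      intro i
      have hd : y V i - y V' i ∈ Uᗮ := by
        rw [← Submodule.starProjection_apply_eq_zero_iff, map_sub, (hy V i (hS' hV)).2,
          (hy V' i (hS' hV')).2, sub_self]
      have hdf : |inner ℝ (y V i - y V' i) f| ≤ 4 * (L * ρ) := by
        rw [inner_sub_left]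
        have h1 := hyf V (hS' hV) i
        have h2 := hyf V' (hS' hV') i
        have h3 := abs_sub (inner ℝ (y V i) f) (inner ℝ (y V' i) f)
        linarith
      have := norm_le_of_mem_orthogonal rfl w hg hd hdf (ρ := ρ) (fun j => by
        rw [inner_sub_left]
        exact hclose V hV V' hV' (i, j))
      rw [Fintype.card_fin, hWc] at this
      have hn : ((n - k - 1 : ℕ) : ℝ) ≤ n := by exact_mod_cast (by omega)
      have := mul_le_mul_of_nonneg_right hn hρ.le
      linarith
    have := norm_starProjection_sub_le_of_graph (hS V (hS' hV) V₁ hV₁) (hS V' (hS' hV') V₁ hV₁) b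
      (by positivity) (fun i => (hy V i (hS' hV)).1) (fun i => (hy V' i (hS' hV')).1)
      (fun i => (hy V i (hS' hV)).2) (fun i => (hy V' i (hS' hV')).2) hdiff
    rw [Fintype.card_fin, hUc] at this
    rw [Gr.dist_eq]
    linarith

/-- The `k`-planes whose projection almost identifies the directions of two orthonormal vectors
form a `k (n - k - 1) + 1`-dimensional family. -/
theorem card_le_of_almost_dependent {n k : ℕ} {L M ρ B : ℝ} (hL : 0 ≤ L) (hM : 0 ≤ M)
    (hρ : 0 < ρ) (hρ1 : ρ ≤ 1) (hLρ : (L + 1) * ρ ≤ 1 / 2) (hB : 0 ≤ B)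
    {v e : EuclideanSpace ℝ (Fin n)} (hv : ‖v‖ = 1) (he : ‖e‖ = 1) (hve : inner ℝ v e = 0)
    (S : Finset (Gr n k)) (hS : ∀ V ∈ S, ∀ V' ∈ S, dist V V' ≤ 1 / 2)
    (hSf : ∀ V ∈ S, ∃ c : ℝ, |c| ≤ M ∧ ‖V.space.starProjection (e - c • v)‖ ≤ L * ρ)
    (h : ∀ S' ⊆ S, (∀ V ∈ S', ∀ V' ∈ S', dist V V' ≤ 2 * k * (n + 8 * (L + 1)) * ρ) →
      (S'.card : ℝ) ≤ B) :
    (S.card : ℝ) ≤ (2 * M + 2) / ρ * ((6 / ρ) ^ (k * (n - k - 1)) * B) := by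
  have hex : ∀ V : Gr n k, ∃ c : ℝ, V ∈ S →
      |c| ≤ M ∧ ‖V.space.starProjection (e - c • v)‖ ≤ L * ρ := by
    intro V
    by_cases hV : V ∈ S
    · obtain ⟨c, hc⟩ := hSf V hV
      exact ⟨c, fun _ => hc⟩
    · exact ⟨0, fun h => absurd h hV⟩
  choose c hc using hex
  -- Grouping the planes by c to within ρ allows one common vector e − c(V₁)v per group, at the cost
  -- of replacing L by L + 1.
  have key := card_le_of_bounded_coordinates (ι := Unit) S (fun V _ => c V) hM hρ hρ1
    (B := (6 / ρ) ^ (k * (n - k - 1)) * B) (by positivity) (fun V hV _ => (hc V hV).1) ?_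
  · simpa using key
  intro S' hS' hclose
  rcases S'.eq_empty_or_nonempty with rfl | ⟨V₁, hV₁⟩
  · simp only [Finset.card_empty, Nat.cast_zero]; positivity
  refine card_le_of_almost_orthogonal (L := L + 1) (f := e - c V₁ • v) (by positivity) hρ hρ1 hLρ hB
    ?_ S' (fun V hV V' hV' => hS V (hS' hV) V' (hS' hV')) ?_
    (fun S'' hS'' => h S'' (hS''.trans hS'))
  · have e1 : inner ℝ (e - c V₁ • v) e = 1 := by
      rw [inner_sub_left, inner_smul_left, hve, real_inner_self_eq_norm_sq, he]; simp
    have := real_inner_le_norm (e - c V₁ • v) e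
    rwa [e1, he, mul_one] at this
  · intro V hV
    have e1 : e - c V₁ • v = (e - c V • v) + (c V - c V₁) • v := by rw [sub_smul]; abel
    rw [e1, map_add]
    refine (norm_add_le _ _).trans ?_
    have h1 := (hc V (hS' hV)).2
    have h2 : ‖V.space.starProjection ((c V - c V₁) • v)‖ ≤ ρ := by
      refine (Submodule.norm_starProjection_apply_le _ _).trans ?_
      rw [norm_smul, hv, mul_one]
      exact hclose V hV V₁ hV₁ ()
    linarith

end LineProjection

/-! ### Two lines in a common slab -/

namespace LineProjection

theorem AffGr.exists_unit_dir {n : ℕ} (l : AffGr n 1) :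
    ∃ v ∈ l.dir.space, ‖v‖ = 1 ∧ ∀ x ∈ l.dir.space, ∃ c : ℝ, x = c • v := by
  obtain ⟨v, hv0, hv⟩ := finrank_eq_one_iff'.mp l.dir.finrank_space
  have hn : ‖(v : EuclideanSpace ℝ (Fin n))‖ ≠ 0 := by simpa using hv0
  refine ⟨‖(v : EuclideanSpace ℝ (Fin n))‖⁻¹ • (v : EuclideanSpace ℝ (Fin n)),
    l.dir.space.smul_mem _ v.2, ?_, fun x hx => ?_⟩
  · rw [norm_smul, norm_inv, norm_norm, inv_mul_cancel₀ hn]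
  · obtain ⟨c, hc⟩ := hv ⟨x, hx⟩
    refine ⟨c * ‖(v : EuclideanSpace ℝ (Fin n))‖, ?_⟩
    rw [smul_smul, mul_assoc, mul_inv_cancel₀ hn, mul_one]
    exact (congrArg Subtype.val hc).symm

theorem norm_sub_inner_smul_sq {E : Type*} [NormedAddCommGroup E] [InnerProductSpace ℝ E]
    {v : E} (hv : ‖v‖ = 1) (x : E) :
    ‖x - inner ℝ v x • v‖ ^ 2 = ‖x‖ ^ 2 - (inner ℝ v x) ^ 2 := by
  rw [norm_sub_sq_real, inner_smul_right, norm_smul, hv, real_inner_comm, Real.norm_eq_abs,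
    mul_one, sq_abs]
  ring

/-- The distance of two lines is seen in the component, orthogonal to the first line, of the
direction of the second line or of the difference of the foot points. -/
theorem dist_le_of_lines {n : ℕ} (l l' : ALoc n 1) {v v' : EuclideanSpace ℝ (Fin n)}
    (hv : v ∈ l.1.dir.space) (hv1 : ‖v‖ = 1) (hvs : ∀ x ∈ l.1.dir.space, ∃ c : ℝ, x = c • v)
    (hv' : v' ∈ l'.1.dir.space) (hv1' : ‖v'‖ = 1)
    (hvs' : ∀ x ∈ l'.1.dir.space, ∃ c : ℝ, x = c • v') :
    dist l l' ≤ 5 / 2 * ‖v' - inner ℝ v v' • v‖ +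
      ‖(l.1.foot - l'.1.foot) - inner ℝ v (l.1.foot - l'.1.foot) • v‖ := by
  set β := ‖v' - inner ℝ v v' • v‖ with hβ
  have hβ' : ‖v - inner ℝ v' v • v'‖ = β := by
    have h1 := norm_sub_inner_smul_sq hv1 v'
    have h2 := norm_sub_inner_smul_sq hv1' v
    rw [hv1, real_inner_comm] at h2
    rw [hv1', ← hβ] at h1
    refine (sq_eq_sq₀ (norm_nonneg _) (by rw [hβ]; exact norm_nonneg _)).mp ?_
    rw [real_inner_comm, h2, h1]
  have hdir : dist l.1.dir l'.1.dir ≤ 2 * β := by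
    refine norm_starProjection_sub_le _ _ (norm_nonneg _) ?_ ?_
    · intro x hx
      obtain ⟨c, rfl⟩ := hvs x hx
      refine (norm_sub_starProjection_le_of_mem _
        (l'.1.dir.space.smul_mem (c * inner ℝ v' v) hv')).trans ?_
      rw [mul_smul, ← smul_sub, norm_smul, norm_smul, hv1, hβ', mul_one, mul_comm]
    · intro x hx
      obtain ⟨c, rfl⟩ := hvs' x hx
      refine (norm_sub_starProjection_le_of_mem _
        (l.1.dir.space.smul_mem (c * inner ℝ v v') hv)).trans ?_
      rw [mul_smul, ← smul_sub, norm_smul, norm_smul, hv1', mul_one, mul_comm, hβ]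
  set d := l.1.foot - l'.1.foot with hd
  -- Each foot is orthogonal to its own line, so the component of d along v is seen only through the
  -- difference of directions. This contributes the 1/2 in the constant 5/2.
  have hin : |inner ℝ v d| ≤ 1 / 2 * β := by
    have e : inner ℝ v d = - inner ℝ (v - inner ℝ v' v • v') l'.1.foot := by
      rw [hd, inner_sub_right, inner_sub_left, inner_smul_left,
        Submodule.inner_right_of_mem_orthogonal hv l.1.foot_mem,
        Submodule.inner_right_of_mem_orthogonal hv' l'.1.foot_mem]
      simp
    rw [e, abs_neg]
    refine (abs_real_inner_le_norm _ _).trans ?_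
    rw [hβ']
    nlinarith [l'.2, norm_nonneg l'.1.foot, norm_nonneg (v' - inner ℝ v v' • v)]
  have hfoot : ‖d‖ ≤ ‖d - inner ℝ v d • v‖ + 1 / 2 * β := by
    have h1 := norm_add_le (d - inner ℝ v d • v) (inner ℝ v d • v)
    rw [sub_add_cancel, norm_smul, hv1, mul_one, Real.norm_eq_abs] at h1
    linarith
  have : dist l l' = dist l.1.dir l'.1.dir + ‖d‖ := by
    rw [hd, ← dist_eq_norm]; rfl
  linarith

/-- One of two vectors, the direction of ℓ' or the difference of the feet, leaves the direction of ℓ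
by at least r/4: if the former does not, the latter does by r − (5/2)(r/4) > r/4. That vector is w,
and e is its normalized component orthogonal to v. -/
theorem exists_orthonormal_of_lines {n : ℕ} (l l' : ALoc n 1) (hll : 0 < dist l l') :
    ∃ v e w : EuclideanSpace ℝ (Fin n), ∃ α β : ℝ, v ∈ l.1.dir.space ∧ ‖v‖ = 1 ∧ ‖e‖ = 1 ∧
      inner ℝ v e = 0 ∧ w = α • v + β • e ∧ |α| ≤ 1 ∧ dist l l' / 4 ≤ β ∧
      ((w ∈ l'.1.dir.space ∧ ‖w‖ = 1) ∨ w = l.1.foot - l'.1.foot) := by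
  obtain ⟨v, hv, hv1, hvs⟩ := l.1.exists_unit_dir
  obtain ⟨v', hv', hv1', hvs'⟩ := l'.1.exists_unit_dir
  have hdist := dist_le_of_lines l l' hv hv1 hvs hv' hv1' hvs'
  have key : ∀ w : EuclideanSpace ℝ (Fin n), ‖w‖ ≤ 1 →
      dist l l' / 4 ≤ ‖w - inner ℝ v w • v‖ →
      ((w ∈ l'.1.dir.space ∧ ‖w‖ = 1) ∨ w = l.1.foot - l'.1.foot) →
      ∃ v e w : EuclideanSpace ℝ (Fin n), ∃ α β : ℝ, v ∈ l.1.dir.space ∧ ‖v‖ = 1 ∧ ‖e‖ = 1 ∧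
      inner ℝ v e = 0 ∧ w = α • v + β • e ∧ |α| ≤ 1 ∧ dist l l' / 4 ≤ β ∧
      ((w ∈ l'.1.dir.space ∧ ‖w‖ = 1) ∨ w = l.1.foot - l'.1.foot) := by
    intro w hw hβ hcase
    have hpos : ‖w - inner ℝ v w • v‖ ≠ 0 := by linarith
    refine ⟨v, ‖w - inner ℝ v w • v‖⁻¹ • (w - inner ℝ v w • v), w, inner ℝ v w,
      ‖w - inner ℝ v w • v‖, hv, hv1, ?_, ?_, ?_, ?_, hβ, hcase⟩
    · rw [norm_smul, norm_inv, norm_norm, inv_mul_cancel₀ hpos]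
    · rw [inner_smul_right, inner_sub_right, inner_smul_right, real_inner_self_eq_norm_sq, hv1]
      simp
    · rw [smul_smul, mul_inv_cancel₀ hpos, one_smul]; abel
    · refine (abs_real_inner_le_norm _ _).trans ?_
      rw [hv1, one_mul]; exact hw
  by_cases hc : dist l l' / 4 ≤ ‖v' - inner ℝ v v' • v‖
  · exact key v' hv1'.le hc (Or.inl ⟨hv', hv1'⟩)
  · refine key _ ?_ ?_ (Or.inr rfl)
    · have := norm_sub_le l.1.foot l'.1.foot
      linarith [l.2, l'.2]
    · linarith

/-- If w = P_{V^⊥}v is nonzero then cos ∠(v, w) = ‖w‖. Hence ‖w‖ ≤ cos μ, and Pythagoras gives the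
bound on P_V v. -/
theorem sin_le_norm_starProjection {n k : ℕ} {μ : ℝ} (hμ0 : 0 < μ) (hμ1 : μ < 1 / 100)
    {l : AffGr n 1} {V : Gr n k} (h : AngleGT μ l V) {v : EuclideanSpace ℝ (Fin n)}
    (hv : v ∈ l.dir.space) (hv1 : ‖v‖ = 1) :
    Real.sin μ ≤ ‖V.space.starProjection v‖ := by
  have hpi := Real.pi_gt_three
  have hs : 0 ≤ Real.sin μ := Real.sin_nonneg_of_nonneg_of_le_pi hμ0.le (by linarith)
  have hpyth := Submodule.norm_sq_eq_add_norm_sq_starProjection v V.space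
  rw [hv1] at hpyth
  set w := V.spaceᗮ.starProjection v with hw
  have hw1 : ‖w‖ ≤ Real.cos μ := by
    by_cases hw0 : w = 0
    · rw [hw0, norm_zero]
      exact Real.cos_nonneg_of_neg_pi_div_two_le_of_le (by linarith) (by linarith)
    have hv0 : v ≠ 0 := by rintro rfl; simp at hv1
    have hang := h v hv hv0 w (Submodule.starProjection_apply_mem _ _) hw0
    have hcos : Real.cos (InnerProductGeometry.angle v w) ≤ Real.cos μ :=
      Real.cos_le_cos_of_nonneg_of_le_pi hμ0.le (InnerProductGeometry.angle_le_pi _ _) hang.le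
    rw [InnerProductGeometry.cos_angle, hv1, one_mul] at hcos
    have hin : inner ℝ v w = ‖w‖ ^ 2 := by
      rw [← real_inner_self_eq_norm_sq]
      conv_rhs => rw [hw, ← hw, Submodule.inner_starProjection_left_eq_right,
        Submodule.starProjection_eq_self_iff.mpr (Submodule.starProjection_apply_mem _ _)]
    have hn : ‖w‖ ≠ 0 := norm_ne_zero_iff.mpr hw0
    rwa [hin, pow_two, mul_div_cancel_right₀ _ hn] at hcos
  have := Real.sin_sq_add_cos_sq μ
  refine abs_le_of_sq_le_sq' ?_ (norm_nonneg _) |>.2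
  nlinarith [norm_nonneg w]

/-- P_V kills V^⊥ and the second projection kills the direction of m, so only the distances of x and
z to the plane remain. Each is below 2r, the doubling being the price of an actual nearby point. -/
theorem norm_proj_sub_le_of_mem_slab {n k : ℕ} {r : ℝ} (hr : 0 < r) {V : Gr n k} {m : AffGr n 1}
    (hm : m.points ⊆ V.space) {x z : EuclideanSpace ℝ (Fin n)}
    (hx : x ∈ slab r (orthPlane V m)) (hz : z ∈ slab r (orthPlane V m)) :
    ‖m.dir.spaceᗮ.starProjection (V.space.starProjection (x - z))‖ ≤ 4 * r := by
  have hdirV : m.dir.space ≤ V.space := by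
    intro g hg
    have h1 : m.foot ∈ V.space := hm ((m.mem_points _).mpr (by simp))
    have h2 : m.foot + g ∈ V.space := hm ((m.mem_points _).mpr (by simpa using hg))
    simpa using V.space.sub_mem h2 h1
  have near : ∀ x ∈ slab r (orthPlane V m), ∃ p ∈ m.points, ∃ y ∈ V.spaceᗮ,
      dist x (p + y) < 2 * r := by
    intro x hx
    have hx' : x ∈ Metric.thickening (2 * r) (orthPlane V m) :=
      Metric.cthickening_subset_thickening' (by linarith) (by linarith) _ hx.1
    obtain ⟨q, ⟨p, hp, y, hy, rfl⟩, hd⟩ := Metric.mem_thickening_iff.mp hx'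
    exact ⟨p, hp, y, hy, hd⟩
  obtain ⟨p, hp, y, hy, hpy⟩ := near x hx
  obtain ⟨q, hq, y', hy', hqy⟩ := near z hz
  rw [dist_eq_norm] at hpy hqy
  have hpq : p - q ∈ m.dir.space := by
    have := m.dir.space.sub_mem ((m.mem_points p).mp hp) ((m.mem_points q).mp hq)
    simpa using this
  have e : m.dir.spaceᗮ.starProjection (V.space.starProjection (x - z)) =
      m.dir.spaceᗮ.starProjection (V.space.starProjection ((x - (p + y)) - (z - (q + y')))) := by
    have h1 : x - z = ((x - (p + y)) - (z - (q + y'))) + ((p - q) + (y - y')) := by abel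
    have h2 : V.space.starProjection (y - y') = 0 :=
      V.space.starProjection_apply_eq_zero_iff.mpr (V.spaceᗮ.sub_mem hy hy')
    have h3 : V.space.starProjection (p - q) = p - q :=
      Submodule.starProjection_eq_self_iff.mpr (hdirV hpq)
    have h4 : m.dir.spaceᗮ.starProjection (p - q) = 0 := by
      rw [Submodule.starProjection_apply_eq_zero_iff, Submodule.orthogonal_orthogonal]
      exact hpq
    rw [h1, map_add, map_add V.space.starProjection (p - q), h2, h3, add_zero, map_add, h4, add_zero]
  rw [e]
  refine (Submodule.norm_starProjection_apply_le _ _).trans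
    ((Submodule.norm_starProjection_apply_le _ _).trans ((norm_sub_le _ _).trans ?_))
  linarith

/-- If two lines lie in a common slab orthogonal to `V`, the projection to `V` almost identifies
the directions of an orthonormal pair that depends only on the two lines. -/
theorem exists_almost_dependent {n k : ℕ} {μ C₀ : ℝ} (hμ0 : 0 < μ) (hμ1 : μ < 1 / 100)
    (hC₀ : 1 ≤ C₀) {δ : ℝ} (hδ : 0 < δ) (hδμ : 16 * C₀ * δ ≤ Real.sin μ)
    (l l' : ALoc n 1) (hll : 0 < dist l l') (hll1 : dist l l' ≤ 1) :
    ∃ v e : EuclideanSpace ℝ (Fin n), ‖v‖ = 1 ∧ ‖e‖ = 1 ∧ inner ℝ v e = 0 ∧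
      ∀ (V : Gr n k) (T : Set (EuclideanSpace ℝ (Fin n))), AngleGT μ l.1 V → IsOrthSlab C₀ δ V T →
        slab δ l.1.points ⊆ T → slab δ l'.1.points ⊆ T →
        ∃ c : ℝ, |c| ≤ 2 / Real.sin μ ∧ ‖V.space.starProjection (e - c • v)‖ ≤
          (64 + 16 / Real.sin μ) * C₀ * (δ / dist l l') := by
  have hσ : 0 < Real.sin μ := Real.sin_pos_of_pos_of_lt_pi hμ0 (by linarith [Real.pi_gt_three])
  set σ := Real.sin μ
  set r := dist l l' with hr
  obtain ⟨v, e, w, α, β, hv, hv1, he1, hve, hw, hα, hβ, hcase⟩ := exists_orthonormal_of_lines l l' hll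
  refine ⟨v, e, hv1, he1, hve, fun V T hang hT hlT hlT' => ?_⟩
  obtain ⟨-, m, hm, -, hTm⟩ := hT
  obtain ⟨g, hg, hg1, hgs⟩ := m.exists_unit_dir
  have hslab : ∀ (l : ALoc n 1), slab δ l.1.points ⊆ T → ∀ x, x ∈ l.1.dir.space → ‖x‖ ≤ 1 / 2 →
      l.1.foot + x ∈ slab (C₀ * δ) (orthPlane V m) := by
    intro l hl x hx hx1
    refine hTm (hl ⟨Metric.self_subset_cthickening _ ((l.1.mem_points _).mpr (by simpa using hx)), ?_⟩)
    rw [mem_closedBall_zero_iff]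
    have := norm_add_le l.1.foot x
    linarith [l.2]
  have hC₀δ : 0 < C₀ * δ := by positivity
  let Q : EuclideanSpace ℝ (Fin n) →L[ℝ] EuclideanSpace ℝ (Fin n) :=
    m.dir.spaceᗮ.starProjection ∘L V.space.starProjection
  have hQ : ∀ x z, x ∈ slab (C₀ * δ) (orthPlane V m) → z ∈ slab (C₀ * δ) (orthPlane V m) →
      ‖Q (x - z)‖ ≤ 4 * (C₀ * δ) := fun x z hx hz => norm_proj_sub_le_of_mem_slab hC₀δ hm hx hz
  -- The points foot and foot + x/2 both lie in the unit ball; halving x doubles the constant 4.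
  have hQdir : ∀ (l : ALoc n 1), slab δ l.1.points ⊆ T → ∀ x, x ∈ l.1.dir.space → ‖x‖ = 1 →
      ‖Q x‖ ≤ 8 * (C₀ * δ) := by
    intro l hl x hx hx1
    have h1 := hQ _ _ (hslab l hl ((1 / 2 : ℝ) • x) (l.1.dir.space.smul_mem _ hx)
      (by rw [norm_smul, hx1]; norm_num)) (hslab l hl 0 (Submodule.zero_mem _) (by norm_num))
    rw [add_sub_add_left_eq_sub, sub_zero, map_smul, norm_smul] at h1
    norm_num at h1
    linarith
  have hQv := hQdir l hlT v hv hv1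
  have hQw : ‖Q w‖ ≤ 8 * (C₀ * δ) := by
    rcases hcase with ⟨h1, h2⟩ | h1
    · exact hQdir l' hlT' w h1 h2
    · have h2 := hQ _ _ (hslab l hlT 0 (Submodule.zero_mem _) (by norm_num))
        (hslab l' hlT' 0 (Submodule.zero_mem _) (by norm_num))
      rw [add_zero, add_zero, ← h1] at h2
      linarith
  have hβ0 : 0 < β := by linarith
  have hQe : ‖Q e‖ ≤ 64 * C₀ * (δ / r) := by
    have e1 : β • e = w - α • v := by rw [hw]; abel
    have e2 : β * ‖Q e‖ = ‖Q w - α • Q v‖ := by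
      rw [← map_smul, ← map_sub, ← e1, map_smul, norm_smul, Real.norm_eq_abs, abs_of_pos hβ0]
    have h1 : ‖Q w - α • Q v‖ ≤ 16 * (C₀ * δ) := by
      refine (norm_sub_le _ _).trans ?_
      rw [norm_smul, Real.norm_eq_abs]
      have := mul_le_mul hα hQv (norm_nonneg _) zero_le_one
      linarith
    have h2 : r / 4 * ‖Q e‖ ≤ β * ‖Q e‖ := mul_le_mul_of_nonneg_right hβ (norm_nonneg _)
    have h3 : 64 * C₀ * (δ / r) = 64 * (C₀ * δ) / r := by ring
    rw [h3, le_div_iff₀ hll]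
    linarith
  have hdec : ∀ x, ∃ h : ℝ, V.space.starProjection x = Q x + h • g ∧ |h| ≤ ‖x‖ := by
    intro x
    obtain ⟨h, hh⟩ := hgs (m.dir.space.starProjection (V.space.starProjection x))
      (Submodule.starProjection_apply_mem _ _)
    refine ⟨h, ?_, ?_⟩
    · rw [← hh]
      change _ = m.dir.spaceᗮ.starProjection (V.space.starProjection x) + _
      rw [Submodule.starProjection_orthogonal_val]; abel
    · have h1 : |h| = ‖h • g‖ := by rw [norm_smul, hg1, mul_one, Real.norm_eq_abs]
      rw [h1, ← hh]
      exact (Submodule.norm_starProjection_apply_le _ _).trans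
        (Submodule.norm_starProjection_apply_le _ _)
  obtain ⟨a, ha, -⟩ := hdec v
  obtain ⟨b, hb, hb1⟩ := hdec e
  rw [he1] at hb1
  -- P_V v has norm at least σ, and `hδμ` makes its part Q v at most σ/2, so the part along m
  -- carries the rest.
  have ha1 : σ / 2 ≤ |a| := by
    have h1 := sin_le_norm_starProjection hμ0 hμ1 hang hv hv1
    have h2 := norm_add_le (Q v) (a • g)
    rw [← ha, norm_smul, hg1, mul_one, Real.norm_eq_abs] at h2
    linarith
  have ha0 : a ≠ 0 := by
    rintro rfl
    rw [abs_zero] at ha1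
    linarith
  have hc : |b / a| ≤ 2 / σ := by
    rw [abs_div, div_le_div_iff₀ (by positivity) hσ]
    nlinarith
  -- This c cancels the components of P_V e and P_V v along m, leaving only values of Q.
  refine ⟨b / a, hc, ?_⟩
  have e3 : V.space.starProjection (e - (b / a) • v) = Q e - (b / a) • Q v := by
    rw [map_sub, map_smul, ha, hb, smul_add, smul_smul, div_mul_cancel₀ _ ha0]; abel
  rw [e3]
  refine (norm_sub_le _ _).trans ?_
  rw [norm_smul, Real.norm_eq_abs]
  have h1 := mul_le_mul hc hQv (norm_nonneg _) (by positivity)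
  have h2 : δ ≤ δ / r := by rw [le_div_iff₀ hll]; nlinarith
  have h3 : 2 / σ * (8 * (C₀ * δ)) ≤ 16 / σ * C₀ * (δ / r) := by
    have : 2 / σ * (8 * (C₀ * δ)) = 16 / σ * C₀ * δ := by ring
    rw [this]
    gcongr
  linarith

end LineProjection

/-! ### Pair counts, dyadic sums and Cauchy–Schwarz -/

namespace LineProjection

theorem IsDeltaSet.card_le {α : Type*} [MetricSpace α] {δ s K : ℝ} {A : Set α}
    (hA : IsDeltaSet δ s K A) {S : Finset α} (hS : (S : Set α) ⊆ A) {x : α} {r : ℝ}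
    (hr : δ ≤ r) (hr1 : r ≤ 1) (hSr : ∀ y ∈ S, dist y x ≤ r) :
    (S.card : ℝ) ≤ K * (r / δ) ^ s := by
  obtain ⟨hfin, hle⟩ := hA.2 x r hr hr1
  have h1 : (S : Set α) ⊆ A ∩ Metric.closedBall x r := fun y hy => ⟨hS hy, hSr y hy⟩
  have h2 := Set.ncard_le_ncard h1 hfin
  rw [Set.ncard_coe_finset] at h2
  exact le_trans (by exact_mod_cast h2) hle

/-- Two lines at distance `r` lie in a common slab orthogonal to `V` only for a
`(δ / r) ^ (t - k (n - k) + (k - 1))`-fraction of the planes `V`. -/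
theorem exists_card_common_slab_le {n k : ℕ} (hk : 1 < k) (hkn : k < n) {μ t C₀ K : ℝ}
    (hμ0 : 0 < μ) (hμ1 : μ < 1 / 100)
    (ht : (k : ℝ) * ((n : ℝ) - (k : ℝ)) - ((k : ℝ) - 1) < t) (hC₀ : 1 ≤ C₀) (hK : 1 ≤ K) :
    ∃ C : ℝ, 0 < C ∧ ∀ δ : ℝ, 0 < δ → δ ≤ 1 → ∀ l l' : ALoc n 1, δ ≤ dist l l' → dist l l' ≤ 1 →
      ∀ 𝒱 S : Finset (Gr n k), IsDeltaSet δ t K (𝒱 : Set (Gr n k)) → S ⊆ 𝒱 →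
      (∀ V ∈ S, ∀ V' ∈ S, dist V V' ≤ 1 / 2) → (∀ V ∈ S, AngleGT μ l.1 V) →
      (∀ V ∈ S, ∃ T, IsOrthSlab C₀ δ V T ∧ slab δ l.1.points ⊆ T ∧ slab δ l'.1.points ⊆ T) →
      (S.card : ℝ) ≤ C * δ ^ (-t) *
        (δ / dist l l') ^ (t - (k : ℝ) * ((n : ℝ) - (k : ℝ)) + ((k : ℝ) - 1)) := by
  have hσ : 0 < Real.sin μ := Real.sin_pos_of_pos_of_lt_pi hμ0 (by linarith [Real.pi_gt_three])
  set γ := t - (k : ℝ) * ((n : ℝ) - (k : ℝ)) + ((k : ℝ) - 1) with hγ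
  have hγ0 : 0 < γ := by linarith
  set N := k * (n - k - 1) with hN
  have hNγ : ((N + 1 : ℕ) : ℝ) = t - γ := by
    have h1 : ((n - k - 1 : ℕ) : ℝ) = n - k - 1 := by
      rw [Nat.sub_sub, Nat.cast_sub (by omega)]; push_cast; ring
    rw [hN, hγ]
    push_cast
    rw [h1]
    ring
  set L := (64 + 16 / Real.sin μ) * C₀ with hL
  have hL0 : 0 ≤ L := by positivity
  set M := 2 / Real.sin μ with hM
  have hM0 : 0 ≤ M := by positivity
  -- The summands serve, in order, the cluster diameter, the smallness (L + 1)ρ ≤ 1/2, the smallness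
  -- of δ against sin μ, and C' ≥ 1.
  set C' := 2 * k * (n + 8 * (L + 1)) + 2 * (L + 1) + 16 * C₀ / Real.sin μ + 1 with hC'
  have hA0 : 0 ≤ 2 * k * (n + 8 * (L + 1)) := by positivity
  have hC₀σ : 0 ≤ 16 * C₀ / Real.sin μ := by positivity
  have hC'1 : 1 ≤ C' := by linarith
  have hC'0 : 0 < C' := by linarith
  refine ⟨(2 * M + 2) * 6 ^ N * (K * C' ^ t) + K * C' ^ γ, by positivity, ?_⟩
  intro δ hδ hδ1 l l' hδr hr1 𝒱 S h𝒱 hS hSd hang hT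
  set r := dist l l' with hr
  have hr0 : 0 < r := hδ.trans_le hδr
  set ρ := δ / r with hρ
  have hρ0 : 0 < ρ := by positivity
  have hρ1 : ρ ≤ 1 := by rw [hρ, div_le_one hr0]; exact hδr
  have hδρ : δ ≤ ρ := by rw [hρ, le_div_iff₀ hr0]; nlinarith
  have hδC' : δ ≤ C' * ρ := by nlinarith
  have hdt : δ ^ (-t) = (1 / δ) ^ t := by
    rw [one_div, Real.inv_rpow hδ.le, Real.rpow_neg hδ.le]
  -- If C'ρ > 1, then ρ^γ is bounded below and the trivial bound Kδ^{-t} suffices.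
  rcases le_or_gt (C' * ρ) 1 with hc | hc
  · have hpieces : 2 * k * (n + 8 * (L + 1)) * ρ ≤ C' * ρ ∧ 2 * (L + 1) * ρ ≤ C' * ρ ∧
        16 * C₀ / Real.sin μ * ρ ≤ C' * ρ :=
      ⟨mul_le_mul_of_nonneg_right (by linarith) hρ0.le,
        mul_le_mul_of_nonneg_right (by linarith) hρ0.le,
        mul_le_mul_of_nonneg_right (by linarith) hρ0.le⟩
    obtain ⟨hp1, hp2, hp3⟩ := hpieces
    have hδμ : 16 * C₀ * δ ≤ Real.sin μ := by
      have h1 : 16 * C₀ / Real.sin μ * δ ≤ 1 :=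
        (mul_le_mul_of_nonneg_left hδρ hC₀σ).trans (hp3.trans hc)
      rwa [div_mul_eq_mul_div, div_le_one hσ] at h1
    obtain ⟨v, e, hv, he, hve, hdep⟩ :=
      exists_almost_dependent (k := k) hμ0 hμ1 hC₀ hδ hδμ l l' hr0 hr1
    have key := card_le_of_almost_dependent (B := K * (C' * ρ / δ) ^ t) hL0 hM0 hρ0 hρ1
      (by linarith) (by positivity) hv he hve S hSd
      (fun V hV => by
        obtain ⟨T, h1, h2, h3⟩ := hT V hV
        exact hdep V T (hang V hV) h1 h2 h3)
      (fun S' hS' hclose => by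
        rcases S'.eq_empty_or_nonempty with rfl | ⟨V₁, hV₁⟩
        · simp only [Finset.card_empty, Nat.cast_zero]; positivity
        · exact h𝒱.card_le (Finset.coe_subset.mpr (hS'.trans hS)) hδC' hc
            (fun V hV => (hclose V hV V₁ hV₁).trans hp1))
    refine key.trans ?_
    have e1 : (2 * M + 2) / ρ * ((6 / ρ) ^ N * (K * (C' * ρ / δ) ^ t)) =
        (2 * M + 2) * 6 ^ N * (K * C' ^ t) * δ ^ (-t) * ρ ^ γ := by
      have h1 : (C' * ρ / δ) ^ t = C' ^ t * (ρ ^ t * δ ^ (-t)) := by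
        rw [mul_div_assoc, Real.mul_rpow hC'0.le (by positivity), Real.div_rpow hρ0.le hδ.le,
          Real.rpow_neg hδ.le]
        rfl
      have h2 : ρ ^ γ = ρ ^ t / ρ ^ (N + 1) := by
        have : γ = t - ((N + 1 : ℕ) : ℝ) := by rw [hNγ]; ring
        rw [this, Real.rpow_sub hρ0, Real.rpow_natCast]
      rw [h1, h2, div_pow, pow_succ ρ N]
      field_simp
    rw [e1]
    have h2 : 0 ≤ K * C' ^ γ * δ ^ (-t) * ρ ^ γ := by positivity
    linarith
  · rcases S.eq_empty_or_nonempty with rfl | ⟨V₁, hV₁⟩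
    · simp only [Finset.card_empty, Nat.cast_zero]; positivity
    have h1 := h𝒱.card_le (Finset.coe_subset.mpr hS) hδ1 le_rfl
      (fun V hV => (hSd V hV V₁ hV₁).trans (by norm_num))
    rw [← hdt] at h1
    have h2 : 1 ≤ C' ^ γ * ρ ^ γ := by
      rw [← Real.mul_rpow hC'0.le hρ0.le]
      exact Real.one_le_rpow hc.le hγ0.le
    have h3 : K * δ ^ (-t) * 1 ≤ K * δ ^ (-t) * (C' ^ γ * ρ ^ γ) := by gcongr
    have h4 : 0 ≤ (2 * M + 2) * 6 ^ N * (K * C' ^ t) * δ ^ (-t) * ρ ^ γ := by positivity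
    linarith

/-- The ring 2^i ≤ dist/δ < 2^{i+1} holds at most K·2^{(i+1)u} points, each contributing at most
2^{-iγ}; since u < γ the series is geometric. Only nonempty rings occur, so distances at most 1/2
keep the outer radius at most 1. -/
theorem IsDeltaSet.sum_rpow_le {α : Type*} [MetricSpace α] [DecidableEq α] {δ u γ K : ℝ}
    (hδ : 0 < δ) (huγ : u < γ) (hγ : 0 < γ) (hK : 0 ≤ K) {H : Finset α}
    (hH : IsDeltaSet δ u K (H : Set α)) (x : α) (hx : ∀ y ∈ H, y ≠ x → δ ≤ dist y x)
    (hx1 : ∀ y ∈ H, dist y x ≤ 1 / 2) :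
    ∑ y ∈ H.erase x, (δ / dist y x) ^ γ ≤ K * 2 ^ u / (1 - 2 ^ (u - γ)) := by
  have hq1 : (2 : ℝ) ^ (u - γ) < 1 := Real.rpow_lt_one_of_one_lt_of_neg (by norm_num) (by linarith)
  have hq0 : (0 : ℝ) ≤ 2 ^ (u - γ) := by positivity
  have hex : ∀ y, ∃ j : ℕ, y ∈ H.erase x →
      (2 : ℝ) ^ j ≤ dist y x / δ ∧ dist y x / δ < 2 ^ (j + 1) := by
    intro y
    by_cases hy : y ∈ H.erase x
    · obtain ⟨hne, hyH⟩ := Finset.mem_erase.mp hy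
      obtain ⟨j, hj⟩ := exists_nat_pow_near (x := dist y x / δ) (y := 2)
        (by rw [le_div_iff₀ hδ, one_mul]; exact hx y hyH hne) one_lt_two
      exact ⟨j, fun _ => hj⟩
    · exact ⟨0, fun h => absurd h hy⟩
  choose j hj using hex
  rw [← Finset.sum_fiberwise_of_maps_to (t := (H.erase x).image j)
    (fun y hy => Finset.mem_image_of_mem j hy)]
  have hfib : ∀ i ∈ (H.erase x).image j, ∑ y ∈ H.erase x with j y = i, (δ / dist y x) ^ γ ≤
      K * 2 ^ u * (2 ^ (u - γ)) ^ i := by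
    intro i hi
    obtain ⟨z, hz, rfl⟩ := Finset.mem_image.mp hi
    set i := j z
    have hcard : (((H.erase x).filter fun y => j y = i).card : ℝ) ≤ K * (2 ^ (i + 1)) ^ u := by
      have h1 := (hj z hz).1
      rw [le_div_iff₀ hδ] at h1
      have h2 := hx1 z (Finset.mem_of_mem_erase hz)
      have h3 := hH.card_le (S := (H.erase x).filter fun y => j y = i) (x := x)
        (r := 2 ^ (i + 1) * δ) (fun y hy => Finset.mem_of_mem_erase (Finset.mem_filter.mp hy).1)
        (by nlinarith [one_le_pow₀ (n := i + 1) (one_le_two : (1 : ℝ) ≤ 2)])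
        (by rw [pow_succ]; linarith)
        (fun y hy => by
          obtain ⟨hy1, hy2⟩ := Finset.mem_filter.mp hy
          have := (hj y hy1).2
          rw [hy2, div_lt_iff₀ hδ] at this
          exact this.le)
      rwa [mul_div_cancel_right₀ _ hδ.ne'] at h3
    have hterm : ∀ y ∈ (H.erase x).filter fun y => j y = i,
        (δ / dist y x) ^ γ ≤ ((2 ^ i : ℝ)⁻¹) ^ γ := by
      intro y hy
      obtain ⟨hy1, hy2⟩ := Finset.mem_filter.mp hy
      have h1 := (hj y hy1).1
      rw [hy2] at h1
      refine Real.rpow_le_rpow (by positivity) ?_ hγ.le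
      rw [← inv_div]
      exact inv_anti₀ (by positivity) h1
    calc ∑ y ∈ H.erase x with j y = i, (δ / dist y x) ^ γ
        ≤ (((H.erase x).filter fun y => j y = i).card : ℝ) * ((2 ^ i : ℝ)⁻¹) ^ γ := by
          rw [← nsmul_eq_mul]; exact Finset.sum_le_card_nsmul _ _ _ hterm
      _ ≤ K * (2 ^ (i + 1)) ^ u * ((2 ^ i : ℝ)⁻¹) ^ γ := by gcongr
      _ = K * 2 ^ u * (2 ^ (u - γ)) ^ i := by
          have h2 : (0 : ℝ) < 2 := by norm_num
          rw [pow_succ, Real.mul_rpow (by positivity) h2.le, Real.inv_rpow (by positivity),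
            ← Real.rpow_natCast, ← Real.rpow_natCast, ← Real.rpow_mul h2.le, ← Real.rpow_mul h2.le,
            ← Real.rpow_mul h2.le, ← Real.rpow_neg h2.le]
          have : (2 : ℝ) ^ ((u - γ) * (i : ℝ)) = 2 ^ ((i : ℝ) * u) * 2 ^ (-((i : ℝ) * γ)) := by
            rw [← Real.rpow_add h2]; congr 1; ring
          rw [this]; ring
  refine (Finset.sum_le_sum hfib).trans ?_
  rw [← Finset.mul_sum, div_eq_mul_inv]
  refine mul_le_mul_of_nonneg_left ?_ (by positivity)
  rw [← tsum_geometric_of_lt_one hq0 hq1]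
  exact (summable_geometric_of_lt_one hq0 hq1).sum_le_tsum _ (fun i _ => pow_nonneg hq0 i)

open Classical in
/-- The `L²` argument: if the members of `H` are covered by few sets of each family `F V`, then
many pairs share a set. -/
theorem sq_sum_card_covered_le {α β τ : Type*} (H : Finset α) (𝒱 : Finset β) (F : β → Finset τ)
    (R : β → α → τ → Prop) :
    (∑ V ∈ 𝒱, ((H.filter fun l => ∃ T ∈ F V, R V l T).card : ℝ)) ^ 2 ≤
      (∑ V ∈ 𝒱, ((F V).card : ℝ)) * ∑ l ∈ H, ∑ l' ∈ H,
        ((𝒱.filter fun V => ∃ T ∈ F V, R V l T ∧ R V l' T).card : ℝ) := by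
  have hsq : ∀ V ∈ 𝒱, ((H.filter fun l => ∃ T ∈ F V, R V l T).card : ℝ) ^ 2 ≤
      ((F V).card : ℝ) *
        (((H ×ˢ H).filter fun p => ∃ T ∈ F V, R V p.1 T ∧ R V p.2 T).card : ℝ) := by
    intro V _
    set HV := H.filter fun l => ∃ T ∈ F V, R V l T with hHV
    rcases HV.eq_empty_or_nonempty with h0 | ⟨l₀, hl₀⟩
    · rw [h0]; simp only [Finset.card_empty, Nat.cast_zero, ne_eq, OfNat.ofNat_ne_zero, not_false_eq_true, zero_pow]; positivity
    obtain ⟨T₀, -⟩ := (Finset.mem_filter.mp hl₀).2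
    -- Choosing one slab per covered line partitions HV into fibres; pairs in one fibre share a
    -- slab, and Cauchy–Schwarz over the fibres bounds (#HV)².
    have hex : ∀ l, ∃ T, l ∈ HV → T ∈ F V ∧ R V l T := by
      intro l
      by_cases hl : l ∈ HV
      · obtain ⟨T, hT⟩ := (Finset.mem_filter.mp hl).2
        exact ⟨T, fun _ => hT⟩
      · exact ⟨T₀, fun h => absurd h hl⟩
    choose T hT using hex
    have h1 := Finset.card_eq_sum_card_fiberwise (f := T) (s := HV) (t := F V)
      (fun l hl => (hT l hl).1)
    have h2 : ∑ S ∈ F V, ((HV.filter fun l => T l = S).card) ^ 2 ≤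
        ((H ×ˢ H).filter fun p => ∃ T ∈ F V, R V p.1 T ∧ R V p.2 T).card := by
      have h3 : ∀ S ∈ F V, ((HV.filter fun l => T l = S).card) ^ 2 =
          (((HV ×ˢ HV).filter fun p => T p.1 = T p.2).filter fun p => T p.1 = S).card := by
        intro S _
        rw [pow_two, ← Finset.card_product]
        congr 1
        ext p
        simp only [Finset.mem_product, Finset.mem_filter]
        constructor
        · rintro ⟨⟨a, b⟩, c, d⟩
          exact ⟨⟨⟨a, c⟩, b.trans d.symm⟩, b⟩
        · rintro ⟨⟨⟨a, c⟩, e⟩, b⟩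
          exact ⟨⟨a, b⟩, c, e.symm.trans b⟩
      rw [Finset.sum_congr rfl h3, ← Finset.card_eq_sum_card_fiberwise
        (f := fun p : α × α => T p.1) (t := F V)]
      · refine Finset.card_le_card fun p hp => ?_
        simp only [Finset.mem_product, Finset.mem_filter] at hp
        obtain ⟨⟨hp1, hp2⟩, he⟩ := hp
        refine Finset.mem_filter.mpr ⟨Finset.mem_product.mpr
          ⟨(Finset.mem_filter.mp hp1).1, (Finset.mem_filter.mp hp2).1⟩,
          T p.1, (hT _ hp1).1, (hT _ hp1).2, he ▸ (hT _ hp2).2⟩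
      · intro p hp
        simp only [Finset.coe_filter, Finset.mem_product, Set.mem_ofPred_eq] at hp
        exact (hT _ hp.1.1).1
    rw [h1]
    push_cast
    refine sq_sum_le_card_mul_sum_sq.trans ?_
    refine mul_le_mul_of_nonneg_left ?_ (by positivity)
    exact_mod_cast h2
  -- A second Cauchy–Schwarz, now over V.
  refine (Finset.sum_sq_le_sum_mul_sum_of_sq_le_mul 𝒱 (fun _ _ => by positivity)
    (fun _ _ => by positivity) hsq).trans ?_
  refine mul_le_mul_of_nonneg_left (le_of_eq ?_) (by positivity)
  rw [← Finset.sum_product']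
  simp only [Finset.card_filter, Nat.cast_sum]
  exact Finset.sum_comm

/-- The slab of thickness 1 about a plane through the origin is the whole unit ball, so the Frostman
condition at r = 1 counts every slab. -/
theorem FrostmanSlabs.cardLE {n k : ℕ} (hk : 0 < k) {C₀ δ s K : ℝ} (hδ1 : δ ≤ 1)
    {V : Gr n k} {𝕋 : Set (Set (EuclideanSpace ℝ (Fin n)))}
    (hslab : ∀ T ∈ 𝕋, IsOrthSlab C₀ δ V T) (h : FrostmanSlabs δ s K V 𝕋) :
    CardLE 𝕋 (K * (1 / δ) ^ s) := by
  have : Nontrivial V.space := by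
    apply Module.nontrivial_of_finrank_pos (R := ℝ)
    rw [V.finrank_space]
    exact hk
  obtain ⟨⟨v, hv⟩, hv0⟩ := exists_ne (0 : V.space)
  have hv0' : v ≠ 0 := fun h => hv0 (Subtype.ext h)
  let m : AffGr n 1 := ⟨⟨ℝ ∙ v, finrank_span_singleton hv0'⟩, 0, Submodule.zero_mem _⟩
  have hmem : ∀ x, x ∈ m.points ↔ x ∈ ℝ ∙ v := fun x => by
    rw [AffGr.mem_points]
    change x - 0 ∈ ℝ ∙ v ↔ _
    rw [sub_zero]
  have hmV : m.points ⊆ V.space := fun x hx =>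
    (Submodule.span_singleton_le_iff_mem v V.space).mpr hv ((hmem x).mp hx)
  have h1 := h 1 hδ1 le_rfl m hmV
  have h2 : {T ∈ 𝕋 | T ⊆ slab 1 (orthPlane V m)} = 𝕋 := by
    refine Set.sep_eq_self_iff_mem_true.mpr fun T hT x hx => ?_
    obtain ⟨-, m', -, -, hT'⟩ := hslab T hT
    have hx1 := (hT' hx).2
    refine ⟨Metric.closedBall_subset_cthickening ?_ 1 hx1, hx1⟩
    exact ⟨0, (hmem 0).mpr (Submodule.zero_mem _), 0, Submodule.zero_mem _, (add_zero 0).symm⟩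
  rwa [h2] at h1

/-- The exponent 10 is what the fifth power of a density (log δ⁻¹)^{-2} costs. -/
theorem log_inv_pow_le {ε δ : ℝ} (hε : 0 < ε) (hδ : 0 < δ) (hδ1 : δ ≤ 1) :
    (Real.log δ⁻¹) ^ 10 ≤ (20 / ε) ^ 10 * δ ^ (-ε / 2) := by
  have h1 := Real.log_le_rpow_div (x := δ⁻¹) (by positivity) (by positivity : 0 < ε / 20)
  have h0 : 0 ≤ Real.log δ⁻¹ := Real.log_nonneg ((one_le_inv₀ hδ).mpr hδ1)
  refine (pow_le_pow_left₀ h0 h1 10).trans (le_of_eq ?_)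
  rw [div_pow, ← Real.rpow_natCast, ← Real.rpow_mul (by positivity), Real.inv_rpow hδ.le,
    ← Real.rpow_neg hδ.le]
  have : -(ε / 20 * ((10 : ℕ) : ℝ)) = -ε / 2 := by push_cast; ring
  rw [this]
  field_simp

end LineProjection

/-! ### The lower bound and the final estimates -/

namespace LineProjection

/-- The lower bound with an explicit logarithmic loss, from the covering hypothesis with a density
`a`. -/
theorem exists_le_sum_card_slabs {n k : ℕ} (hk : 1 < k) (hkn : k < n)
    {μ t u C₀ K : ℝ} (hμ0 : 0 < μ) (hμ1 : μ < 1 / 100)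
    (ht : (k : ℝ) * ((n : ℝ) - (k : ℝ)) - ((k : ℝ) - 1) < t)
    (hu : u < t - (k : ℝ) * ((n : ℝ) - (k : ℝ)) + ((k : ℝ) - 1)) (hC₀ : 1 ≤ C₀) (hK : 1 ≤ K) :
    ∃ C : ℝ, 0 < C ∧ ∀ δ a : ℝ, 0 < δ → δ ≤ 1 → 0 < a →
      ∀ (l₀ : ALoc n 1) (V₀ : Gr n k),
      (∀ l ∈ Metric.closedBall l₀ μ, ∀ V ∈ Metric.closedBall V₀ μ, AngleGT μ l.1 V) →
      ∀ (H : Finset (ALoc n 1)) (𝒱 : Finset (Gr n k))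
        (F : Gr n k → Finset (Set (EuclideanSpace ℝ (Fin n)))),
      (H : Set (ALoc n 1)) ⊆ Metric.closedBall l₀ μ →
      IsDeltaSet δ u K (H : Set (ALoc n 1)) →
      a * δ ^ (-u) ≤ (H.card : ℝ) →
      (𝒱 : Set (Gr n k)) ⊆ Metric.closedBall V₀ μ →
      IsDeltaSet δ t K (𝒱 : Set (Gr n k)) →
      a * δ ^ (-t) ≤ (𝒱.card : ℝ) →
      (∀ V ∈ 𝒱, ∀ T ∈ F V, IsOrthSlab C₀ δ V T) →
      (∀ l ∈ H, a * (𝒱.card : ℝ) ≤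
        ({V : Gr n k | V ∈ 𝒱 ∧ ∃ T ∈ F V, slab δ l.1.points ⊆ T}.ncard : ℝ)) →
      a ^ 5 * δ ^ (-u - t) ≤ C * ∑ V ∈ 𝒱, ((F V).card : ℝ) := by
  classical
  obtain ⟨C₁, hC₁, hpair⟩ := exists_card_common_slab_le hk hkn hμ0 hμ1 ht hC₀ hK
  set γ := t - (k : ℝ) * ((n : ℝ) - (k : ℝ)) + ((k : ℝ) - 1) with hγ
  have hγ0 : 0 < γ := by linarith
  set G := K * 2 ^ u / (1 - 2 ^ (u - γ)) with hG
  have hG0 : 0 ≤ G := by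
    have : (2 : ℝ) ^ (u - γ) < 1 :=
      Real.rpow_lt_one_of_one_lt_of_neg (by norm_num) (by linarith)
    exact div_nonneg (by positivity) (by linarith)
  -- K bounds the diagonal pairs, and C₁G the off-diagonal ones via the dyadic sum.
  refine ⟨K + C₁ * G, by positivity, ?_⟩
  intro δ a hδ hδ1 ha l₀ V₀ hang H 𝒱 F hHl hH hHc h𝒱V h𝒱 h𝒱c hslab hcov
  have hdV : ∀ V ∈ 𝒱, ∀ V' ∈ 𝒱, dist V V' ≤ 1 / 2 := by
    intro V hV V' hV'
    have h1 : dist V V₀ ≤ μ := h𝒱V hV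
    have h2 : dist V' V₀ ≤ μ := h𝒱V hV'
    linarith [dist_triangle_right V V' V₀]
  have hdH : ∀ l ∈ H, ∀ l' ∈ H, dist l l' ≤ 1 / 2 := by
    intro l hl l' hl'
    have h1 : dist l l₀ ≤ μ := hHl hl
    have h2 : dist l' l₀ ≤ μ := hHl hl'
    linarith [dist_triangle_right l l' l₀]
  have hdt : δ ^ (-t) = (1 / δ) ^ t := by
    rw [one_div, Real.inv_rpow hδ.le, Real.rpow_neg hδ.le]
  have hdt0 : 0 < δ ^ (-t) := by positivity
  have hdu0 : 0 < δ ^ (-u) := by positivity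
  have hinner : ∀ l ∈ H, ∑ l' ∈ H, ((𝒱.filter fun V => ∃ T ∈ F V,
      slab δ l.1.points ⊆ T ∧ slab δ l'.1.points ⊆ T).card : ℝ) ≤ (K + C₁ * G) * δ ^ (-t) := by
    intro l hl
    rw [← Finset.add_sum_erase H _ hl]
    have hself : ((𝒱.filter fun V => ∃ T ∈ F V,
        slab δ l.1.points ⊆ T ∧ slab δ l.1.points ⊆ T).card : ℝ) ≤ K * δ ^ (-t) := by
      rcases 𝒱.eq_empty_or_nonempty with h0 | ⟨V₁, hV₁⟩
      · rw [h0]; simp only [Finset.filter_empty, Finset.card_empty, Nat.cast_zero]; positivity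
      · rw [hdt]
        exact h𝒱.card_le (Finset.coe_subset.mpr (Finset.filter_subset _ _)) hδ1 le_rfl
          (fun V hV => (hdV V (Finset.mem_filter.mp hV).1 V₁ hV₁).trans (by norm_num))
    have hother : ∀ l' ∈ H.erase l, ((𝒱.filter fun V => ∃ T ∈ F V,
        slab δ l.1.points ⊆ T ∧ slab δ l'.1.points ⊆ T).card : ℝ) ≤
        C₁ * δ ^ (-t) * (δ / dist l' l) ^ γ := by
      intro l' hl'
      obtain ⟨hne, hl'H⟩ := Finset.mem_erase.mp hl'
      rw [dist_comm l' l]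
      refine hpair δ hδ hδ1 l l' (hH.1 l hl l' hl'H hne.symm)
        ((hdH l hl l' hl'H).trans (by norm_num)) 𝒱 _ h𝒱 (Finset.filter_subset _ _) ?_ ?_ ?_
      · exact fun V hV V' hV' =>
          hdV V (Finset.mem_filter.mp hV).1 V' (Finset.mem_filter.mp hV').1
      · exact fun V hV => hang l (hHl hl) V (h𝒱V (Finset.mem_filter.mp hV).1)
      · intro V hV
        obtain ⟨hV1, T, hT, h1, h2⟩ := Finset.mem_filter.mp hV
        exact ⟨T, hslab V hV1 T hT, h1, h2⟩
    have hgeom := hH.sum_rpow_le hδ hu hγ0 (by linarith) l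
      (fun y hy hne => hH.1 y hy l hl hne) (fun y hy => hdH y hy l hl)
    have h1 := Finset.sum_le_sum hother
    rw [← Finset.mul_sum] at h1
    have h2 : C₁ * δ ^ (-t) * ∑ y ∈ H.erase l, (δ / dist y l) ^ γ ≤ C₁ * δ ^ (-t) * G := by gcongr
    linarith
  have hL2 := sq_sum_card_covered_le H 𝒱 F (fun _ l T => slab δ l.1.points ⊆ T)
  have hW : a * 𝒱.card * H.card ≤
      ∑ V ∈ 𝒱, ((H.filter fun l => ∃ T ∈ F V, slab δ l.1.points ⊆ T).card : ℝ) := by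
    have hswap : ∑ V ∈ 𝒱, ((H.filter fun l => ∃ T ∈ F V, slab δ l.1.points ⊆ T).card : ℝ) =
        ∑ l ∈ H, ((𝒱.filter fun V => ∃ T ∈ F V, slab δ l.1.points ⊆ T).card : ℝ) := by
      simp only [Finset.card_filter, Nat.cast_sum]
      exact Finset.sum_comm
    rw [hswap, mul_comm, ← nsmul_eq_mul]
    refine Finset.card_nsmul_le_sum _ _ _ fun l hl => (hcov l hl).trans (le_of_eq ?_)
    rw [← Set.ncard_coe_finset]
    congr 2
    ext V
    simp
  have hP := Finset.sum_le_sum hinner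
  rw [Finset.sum_const, nsmul_eq_mul] at hP
  set X := ∑ V ∈ 𝒱, ((F V).card : ℝ) with hX
  have hX0 : 0 ≤ X := Finset.sum_nonneg fun _ _ => by positivity
  set h := (H.card : ℝ)
  set v := (𝒱.card : ℝ)
  have hh : 0 < h := lt_of_lt_of_le (by positivity) hHc
  have h1 : (a * v * h) ^ 2 ≤ X * (h * ((K + C₁ * G) * δ ^ (-t))) :=
    (pow_le_pow_left₀ (by positivity) hW 2).trans
      (hL2.trans (mul_le_mul_of_nonneg_left hP hX0))
  have h2 : a ^ 2 * v ^ 2 * h ≤ (K + C₁ * G) * X * δ ^ (-t) := by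
    refine le_of_mul_le_mul_right ?_ hh
    linarith [h1]
  -- Two factors a come from the covering hypothesis, two from v², and one from h.
  have h3 : a ^ 5 * δ ^ (-u) * δ ^ (-t) * δ ^ (-t) ≤ a ^ 2 * v ^ 2 * h := by
    have e : a ^ 5 * δ ^ (-u) * δ ^ (-t) * δ ^ (-t) =
        a ^ 2 * (a * δ ^ (-t)) ^ 2 * (a * δ ^ (-u)) := by ring
    rw [e]
    gcongr
  have h4 : δ ^ (-u - t) = δ ^ (-u) * δ ^ (-t) := by rw [← Real.rpow_add hδ]; rfl
  rw [h4, ← mul_assoc]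
  exact le_of_mul_le_mul_right (h3.trans h2) hdt0

end LineProjection

open LineProjection
theorem theorem4p1 (n k : ℕ) (hk : 1 < k) (hkn : k < n)
    (μ : ℝ) (hμ0 : 0 < μ) (hμ1 : μ < 1 / 100) (s t u : ℝ)
    (ht : (k : ℝ) * ((n : ℝ) - (k : ℝ)) - ((k : ℝ) - 1) < t)
    (hs : 0 < s) (hu0 : 0 < u)
    (hu : u < t - (k : ℝ) * ((n : ℝ) - (k : ℝ)) + ((k : ℝ) - 1)) :
    ∃ ε₀ : ℝ, 0 < ε₀ ∧ ∀ C₀ K : ℝ, 1 ≤ C₀ → 1 ≤ K →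
      ∃ C : ℝ, 0 < C ∧ ∀ ε : ℝ, 0 < ε → ε < ε₀ →
      ∃ Cε : ℝ, 0 < Cε ∧
      ∀ δ : ℝ, 0 < δ → δ < 1 / 100 →
      ∀ (l₀ : ALoc n 1) (V₀ : Gr n k),
      (∀ l ∈ Metric.closedBall l₀ μ, ∀ V ∈ Metric.closedBall V₀ μ, AngleGT μ l.1 V) →
      ∀ (H : Finset (ALoc n 1)) (𝒱 : Finset (Gr n k))
        (𝕋 : Gr n k → Set (Set (EuclideanSpace ℝ (Fin n)))),
      (H : Set (ALoc n 1)) ⊆ Metric.closedBall l₀ μ →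
      IsDeltaSet δ u K (H : Set (ALoc n 1)) →
      K⁻¹ * (Real.log δ⁻¹) ^ (-2 : ℤ) * δ ^ (-u) ≤ (H.card : ℝ) →
      (𝒱 : Set (Gr n k)) ⊆ Metric.closedBall V₀ μ →
      IsDeltaSet δ t K (𝒱 : Set (Gr n k)) →
      K⁻¹ * (Real.log δ⁻¹) ^ (-2 : ℤ) * δ ^ (-t) ≤ (𝒱.card : ℝ) →
      (∀ V ∈ 𝒱, ∀ T ∈ 𝕋 V, IsOrthSlab C₀ δ V T) →
      (∀ V ∈ 𝒱, FrostmanSlabs δ s K V (𝕋 V)) →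
      (∀ l ∈ H, K⁻¹ * (Real.log δ⁻¹) ^ (-2 : ℤ) * (𝒱.card : ℝ) ≤
        ({V : Gr n k | V ∈ 𝒱 ∧ ∃ T ∈ 𝕋 V, slab δ l.1.points ⊆ T}.ncard : ℝ)) →
      (∀ V ∈ 𝒱, (𝕋 V).Finite) ∧
      δ ^ (-u - t) ≤ Cε * (δ ^ (-ε / 2) * ∑ V ∈ 𝒱, ((𝕋 V).ncard : ℝ)) ∧
      δ ^ (-ε / 2) * ∑ V ∈ 𝒱, ((𝕋 V).ncard : ℝ) ≤ C * δ ^ (-ε - t - s) := by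
  classical
  -- `K ^ 2` is one factor from #𝒱 and one from each #𝕋_V; `ε₀` may be any positive number.
  refine ⟨1, one_pos, fun C₀ K hC₀ hK => ⟨K ^ 2, by positivity, fun ε hε hε1 => ?_⟩⟩
  obtain ⟨C₁, hC₁, hlower⟩ := exists_le_sum_card_slabs hk hkn hμ0 hμ1 ht hu hC₀ hK
  refine ⟨C₁ * K ^ 5 * (20 / ε) ^ 10, by positivity, ?_⟩
  intro δ hδ hδ1 l₀ V₀ hang H 𝒱 𝕋 hHl hH hHc h𝒱V h𝒱 h𝒱c hslab hfrost hcov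
  have hδ1' : δ ≤ 1 := by linarith
  have hcard : ∀ V ∈ 𝒱, CardLE (𝕋 V) (K * (1 / δ) ^ s) := fun V hV =>
    (hfrost V hV).cardLE (by omega) hδ1' (hslab V hV)
  have hfin : ∀ V ∈ 𝒱, (𝕋 V).Finite := fun V hV => (hcard V hV).1
  have hinv : ∀ x : ℝ, (1 / δ) ^ x = δ ^ (-x) := fun x => by
    rw [one_div, Real.inv_rpow hδ.le, Real.rpow_neg hδ.le]
  refine ⟨hfin, ?_, ?_⟩
  · let F : Gr n k → Finset (Set (EuclideanSpace ℝ (Fin n))) := fun V =>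
      if h : (𝕋 V).Finite then h.toFinset else ∅
    have hF : ∀ V ∈ 𝒱, ∀ T, T ∈ F V ↔ T ∈ 𝕋 V := fun V hV T => by simp [F, hfin V hV]
    have hFc : ∑ V ∈ 𝒱, ((F V).card : ℝ) = ∑ V ∈ 𝒱, ((𝕋 V).ncard : ℝ) := by
      refine Finset.sum_congr rfl fun V hV => ?_
      rw [← Set.ncard_coe_finset]
      congr 2
      ext T
      exact hF V hV T
    have hlog : 0 < Real.log δ⁻¹ := Real.log_pos (by rw [one_lt_inv₀ hδ]; linarith)
    have key := hlower δ (K⁻¹ * (Real.log δ⁻¹) ^ (-2 : ℤ)) hδ hδ1' (by positivity) l₀ V₀ hang H 𝒱 F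
      hHl hH hHc h𝒱V h𝒱 h𝒱c (fun V hV T hT => hslab V hV T ((hF V hV T).mp hT))
      (fun l hl => (hcov l hl).trans (le_of_eq (by
        congr 2
        ext V
        exact and_congr_right fun hV => exists_congr fun T => by rw [hF V hV T])))
    rw [hFc] at key
    set X := ∑ V ∈ 𝒱, ((𝕋 V).ncard : ℝ) with hX
    have hX0 : 0 ≤ X := Finset.sum_nonneg fun _ _ => by positivity
    have e : (K⁻¹ * (Real.log δ⁻¹) ^ (-2 : ℤ)) ^ 5 = (K ^ 5 * (Real.log δ⁻¹) ^ 10)⁻¹ := by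
      rw [zpow_neg, mul_pow, mul_inv, inv_pow, inv_pow]
      norm_cast
      rw [← pow_mul]
    rw [e, inv_mul_le_iff₀ (by positivity)] at key
    refine key.trans ?_
    have hl := log_inv_pow_le hε hδ hδ1'
    calc K ^ 5 * (Real.log δ⁻¹) ^ 10 * (C₁ * X)
        ≤ K ^ 5 * ((20 / ε) ^ 10 * δ ^ (-ε / 2)) * (C₁ * X) := by gcongr
      _ = _ := by ring
  · have h𝒱c' : (𝒱.card : ℝ) ≤ K * (1 / δ) ^ t := h𝒱.card_le subset_rfl (x := V₀) hδ1' le_rfl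
      (fun V hV => (h𝒱V hV : dist V V₀ ≤ μ).trans (by linarith))
    have hsum : ∑ V ∈ 𝒱, ((𝕋 V).ncard : ℝ) ≤ K * (1 / δ) ^ t * (K * (1 / δ) ^ s) := by
      refine (Finset.sum_le_card_nsmul _ _ _ fun V hV => (hcard V hV).2).trans ?_
      rw [nsmul_eq_mul]
      gcongr
    rw [hinv, hinv] at hsum
    have hε2 : δ ^ (-ε / 2) ≤ δ ^ (-ε) :=
      Real.rpow_le_rpow_of_exponent_ge hδ hδ1' (by linarith)
    have e : δ ^ (-ε - t - s) = δ ^ (-ε) * δ ^ (-t) * δ ^ (-s) := by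
      rw [← Real.rpow_add hδ, ← Real.rpow_add hδ]; rfl
    rw [e]
    calc δ ^ (-ε / 2) * ∑ V ∈ 𝒱, ((𝕋 V).ncard : ℝ)
        ≤ δ ^ (-ε) * (K * δ ^ (-t) * (K * δ ^ (-s))) := by gcongr
      _ = _ := by ring
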